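/- Let $(R,\mathfrak m)$ be a Cohen–Macaulay (Noetherian) local ring of dimension $d\ge 2$ with infinite residue field, and let $I$ be an $\mathfrak m$-primary ideal of $R$. Let $G(I)=\bigoplus_{n\ge 0} I^n/I^{n+1}$ be the associated graded ring of $I$ and $F(I)=\bigoplus_{n\ge 0} I^n/\mathfrak m I^n$ its fiber cone, and let $\lambda(-)$ denote the length of an $R$-module. An ideal $J\subseteq I$ is a reduction of $I$ if $I^{n+1}=JI^n$ for some $n\ge 0$, and a minimal reduction if it is minimal with respect to inclusion among the reductions of $I$. Suppose that $\operatorname{depth} G(I)\ge d-1$, where the depth is the supremum of the lengths of the regular sequences of $G(I)$ contained in its homogeneous maximal ideal $\mathfrak m/I\oplus\bigoplus_{n\ge 1}I^n/I^{n+1}$, and let $J$ be a minimal reduction of $I$. 1. If $\lambda(\mathfrak m I/\mathfrak m J)=1=\lambda(\mathfrak m I^2/\mathfrak m IJ)$ and $\mathfrak m I^{n+1}=\mathfrak m I^nJ$ for all $n\ge 2$, then $F(I)$ is Cohen–Macaulay if and only if $\mathfrak m I^2\cap JI=\mathfrak m IJ$. 2. If $\lambda(\mathfrak m I/\mathfrak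 m J)=2$ and $\mathfrak m I^2=\mathfrak m JI$, then $F(I)$ is Cohen–Macaulay. -/

import Mathlib

open IsLocalRing

/-- The ideal `⨁ₙ 𝔞 Iⁿ tⁿ` of the Rees algebra `⨁ₙ Iⁿ tⁿ ⊆ R[t]`. -/
def reesCoeffIdeal {R : Type*} [CommRing R] (𝔞 I : Ideal R) : Ideal (reesAlgebra I) where
  carrier := {f | ∀ n, (f : Polynomial R).coeff n ∈ 𝔞 * I ^ n}
  zero_mem' := fun n => by simp
  add_mem' := fun {f g} hf hg n => by
    simpa using (𝔞 * I ^ n).add_mem (hf n) (hg n)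
  smul_mem' := fun c f hf n => by
    change ((c * f : reesAlgebra I) : Polynomial R).coeff n ∈ 𝔞 * I ^ n
    rw [Subalgebra.coe_mul, Polynomial.coeff_mul]
    refine Ideal.sum_mem _ fun p hp => ?_
    rw [← Finset.HasAntidiagonal.mem_antidiagonal.mp hp, pow_add, mul_left_comm]
    exact Ideal.mul_mem_mul (c.2 p.1) (hf p.2)

/-- The graded ring `⨁ₙ Iⁿ / 𝔞 Iⁿ`, as the quotient of the Rees algebra `⨁ₙ Iⁿ tⁿ` by its
homogeneous ideal `⨁ₙ 𝔞 Iⁿ tⁿ`. -/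
abbrev BlowupQuotient {R : Type*} [CommRing R] (𝔞 I : Ideal R) : Type _ :=
  reesAlgebra I ⧸ reesCoeffIdeal 𝔞 I

/-- The associated graded ring `G(I) = ⨁ₙ Iⁿ / Iⁿ⁺¹`. -/
abbrev AssociatedGradedRing {R : Type*} [CommRing R] (I : Ideal R) : Type _ :=
  BlowupQuotient I I

/-- The fiber cone `F(I) = ⨁ₙ Iⁿ / 𝔪 Iⁿ` of an ideal `I` of a local ring `(R, 𝔪)`. -/
abbrev FiberCone {R : Type*} [CommRing R] [IsLocalRing R] (I : Ideal R) : Type _ :=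
  BlowupQuotient (maximalIdeal R) I

/-- The ideal `𝔪 ⊕ ⨁_{n ≥ 1} Iⁿ tⁿ` of the Rees algebra of an ideal `I` of a local ring. -/
noncomputable def reesIrrelevantIdeal {R : Type*} [CommRing R] [IsLocalRing R] (I : Ideal R) :
    Ideal (reesAlgebra I) :=
  (maximalIdeal R).comap
    ((Polynomial.constantCoeff : Polynomial R →+* R).comp (reesAlgebra I).val.toRingHom)

/-- The homogeneous maximal ideal `𝔪/I ⊕ ⨁_{n ≥ 1} Iⁿ/Iⁿ⁺¹` of the associated graded ring of
a proper ideal `I` of a local ring. -/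
noncomputable def AssociatedGradedRing.irrelevantIdeal {R : Type*} [CommRing R] [IsLocalRing R] (I : Ideal R) :
    Ideal (AssociatedGradedRing I) :=
  (reesIrrelevantIdeal I).map (Ideal.Quotient.mk (reesCoeffIdeal I I))

/-- The grade of the ideal `I` of `A`: the supremum of the lengths of the `A`-regular sequences
contained in `I`. -/
noncomputable def Ideal.regularGrade {A : Type*} [CommRing A] (I : Ideal A) : ℕ∞ :=
  ⨆ (rs : List A) (_ : ∀ r ∈ rs, r ∈ I) (_ : RingTheory.Sequence.IsRegular A rs),
    (rs.length : ℕ∞)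

/-- `depth G(I)`, taken with respect to the homogeneous maximal ideal of `G(I)`. -/
noncomputable def depthAssociatedGradedRing {R : Type*} [CommRing R] [IsLocalRing R]
    (I : Ideal R) : ℕ∞ :=
  Ideal.regularGrade (A := AssociatedGradedRing I) (AssociatedGradedRing.irrelevantIdeal I)

/-- A Noetherian local ring is Cohen–Macaulay if its depth equals its Krull dimension. -/
def IsCohenMacaulayLocalRing (A : Type*) [CommRing A] [IsLocalRing A] : Prop :=
  IsNoetherianRing A ∧ (((maximalIdeal A).regularGrade : ℕ∞) : WithBot ℕ∞) = ringKrullDim A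

/-- A Noetherian ring is Cohen–Macaulay if its localizations at all maximal ideals are
Cohen–Macaulay local rings. -/
def IsCohenMacaulayRing (A : Type*) [CommRing A] : Prop :=
  IsNoetherianRing A ∧
    ∀ (𝔫 : Ideal A) [𝔫.IsMaximal], IsCohenMacaulayLocalRing (Localization.AtPrime 𝔫)

/-- `J` is a reduction of `I`: `J ⊆ I` and `Iⁿ⁺¹ = J Iⁿ` for some `n ≥ 0`. -/
def IsReduction {R : Type*} [CommRing R] (J I : Ideal R) : Prop :=
  J ≤ I ∧ ∃ n : ℕ, I ^ (n + 1) = J * I ^ n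

/-- `J` is a minimal reduction of `I`: it is minimal under inclusion among all reductions. -/
def IsMinimalReduction {R : Type*} [CommRing R] (J I : Ideal R) : Prop :=
  Minimal (fun K : Ideal R => IsReduction K I) J

/-- The length `λ(K/L)` of the `R`-module `K/L` for ideals `L ⊆ K` (in general, of
`K/(L ∩ K)`). -/
noncomputable def lengthQuotient {R : Type*} [CommRing R] (K L : Ideal R) : ℕ∞ :=
  Module.length R (K ⧸ (Submodule.comap K.subtype L : Submodule R K))

/-! Everything rests on the conditions `J Iⁿ ∩ 𝔪 Iⁿ⁺¹ ⊆ 𝔪 J Iⁿ`. For `n = 0` this follows from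
minimality of `J` and Nakayama; for `n ≥ 2` it follows from `𝔪 Iⁿ⁺¹ = 𝔪 J Iⁿ`. Only `n = 1` is at
stake: in case 1 it is the stated equality, in case 2 it comes from `𝔪 I² = 𝔪 J I`.

Sufficiency. Since `depth G(I) ≥ d - 1`, generic elements of `J` give generators `a₁, …, a_d` that
are regular in `R`, with the forms of the first `d - 1` regular in `G(I)`
(`exists_generators_of_isBlowup`). The Valabrega–Valla equalities for these truncations, together
with the conditions above, make the forms of all `aᵢ` regular in `F(I)` (`formRegular_of_inf_le`).
Then `F(I)` is finite and free over `k[X₁, …, X_d]`, `k` the residue field, hence Cohen–Macaulay at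
every maximal ideal.

Necessity. If `F(I)` is Cohen–Macaulay, localizing at its homogeneous maximal ideal and choosing
generic elements gives generators of `J` with regular forms in `F(I)`
(`exists_formRegular_of_isCohenMacaulay`). Regularity in degree one then yields the equality for `n
= 1` (`FormRegular.inf_le`). -/

namespace Blowup

/-! ### Homogeneous elements and ideals of degree one forms in `⨁ₙ Iⁿ / 𝔞 Iⁿ`. -/

variable {R : Type*} [CommRing R]

/-- The `n`-th graded piece of `𝔞 Iⁿ ⊕ Q Iⁿ⁻¹`, the ideal of the Rees algebra generated by `𝔞` and
by the degree one forms of `Q`. -/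
def slice (𝔞 I Q : Ideal R) : ℕ → Ideal R
  | 0 => 𝔞
  | n + 1 => 𝔞 * I ^ (n + 1) ⊔ Q * I ^ n

theorem mul_le_slice (𝔞 I Q : Ideal R) (n : ℕ) : 𝔞 * I ^ n ≤ slice 𝔞 I Q n := by
  cases n with
  | zero => simp [slice]
  | succ n => exact le_sup_left

theorem pow_mul_slice_le (𝔞 I Q : Ideal R) (m n : ℕ) :
    I ^ m * slice 𝔞 I Q n ≤ slice 𝔞 I Q (m + n) := by
  cases n with
  | zero =>
    rw [mul_comm]
    exact mul_le_slice 𝔞 I Q m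
  | succ n =>
    rw [slice, Ideal.mul_sup, ← add_assoc, slice]
    refine sup_le_sup (le_of_eq ?_) (le_of_eq ?_) <;> ring

/-- The ideal of the Rees algebra with graded pieces `slice 𝔞 I Q n`. -/
def sliceIdeal (𝔞 I Q : Ideal R) : Ideal (reesAlgebra I) where
  carrier := {f | ∀ n, (f : Polynomial R).coeff n ∈ slice 𝔞 I Q n}
  zero_mem' := fun n => by simp
  add_mem' := fun {f g} hf hg n => by
    simpa using (slice 𝔞 I Q n).add_mem (hf n) (hg n)
  smul_mem' := fun c f hf n => by
    change ((c * f : reesAlgebra I) : Polynomial R).coeff n ∈ slice 𝔞 I Q n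
    rw [Subalgebra.coe_mul, Polynomial.coeff_mul]
    refine Ideal.sum_mem _ fun p hp => ?_
    rw [← Finset.HasAntidiagonal.mem_antidiagonal.mp hp]
    exact pow_mul_slice_le _ _ _ _ _ (Ideal.mul_mem_mul (c.2 p.1) (hf p.2))

theorem ofList_map_val_le {I : Ideal R} (as : List ↥I) :
    Ideal.ofList (as.map Subtype.val) ≤ I := by
  refine Ideal.span_le.mpr fun z hz => ?_
  obtain ⟨a, ha, rfl⟩ := List.mem_map.mp hz
  exact a.2

/-- The element `u tⁿ` of the Rees algebra, for `u ∈ Iⁿ`. -/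
noncomputable def reesMonomial (I : Ideal R) (n : ℕ) : ↥(I ^ n) →ₗ[R] reesAlgebra I :=
  (Polynomial.monomial n).restrict (q := Subalgebra.toSubmodule (reesAlgebra I))
      (fun _ hu => reesAlgebra.monomial_mem.mpr hu)

theorem coe_reesMonomial {I : Ideal R} {n : ℕ} (u : ↥(I ^ n)) :
    (reesMonomial I n u : Polynomial R) = Polynomial.monomial n u.1 := rfl

/-- `π` presents `A` as the graded ring `⨁ₙ Iⁿ / 𝔞 Iⁿ`. -/
structure IsBlowup {I : Ideal R} {A : Type*} [CommRing A] [Algebra R A] (𝔞 : Ideal R)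
    (π : reesAlgebra I →ₐ[R] A) : Prop where
  surjective : Function.Surjective π
  eq_zero_iff : ∀ f, π f = 0 ↔ f ∈ reesCoeffIdeal 𝔞 I

variable {𝔞 I : Ideal R} {A : Type*} [CommRing A] [Algebra R A]

section

variable (π : reesAlgebra I →ₐ[R] A)

/-- The class of `u tⁿ`, for `u ∈ Iⁿ`. -/
noncomputable def of (n : ℕ) : ↥(I ^ n) →ₗ[R] A := π.toLinearMap ∘ₗ reesMonomial I n

theorem of_apply (n : ℕ) (u : ↥(I ^ n)) : of π n u = π (reesMonomial I n u) := rfl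

/-- The class of `a t`, for `a ∈ I`. -/
noncomputable def degOne : ↥I →ₗ[R] A :=
  of π 1 ∘ₗ (LinearEquiv.ofEq I (I ^ 1) (pow_one I).symm).toLinearMap

theorem degOne_apply (a : ↥I) : degOne π a = π (reesMonomial I 1 ⟨a.1, by simp⟩) := rfl

theorem degOne_mul_of {n : ℕ} (a : ↥I) (v : ↥(I ^ n)) :
    degOne π a * of π n v =
      of π (n + 1) ⟨a * v, by rw [pow_succ']; exact Ideal.mul_mem_mul a.2 v.2⟩ := by
  rw [of_apply, of_apply, degOne_apply, ← map_mul]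
  congr 1
  refine Subtype.ext ((Polynomial.monomial_mul_monomial 1 n a.1 v.1).trans ?_)
  rw [add_comm, coe_reesMonomial]

theorem map_eq_sum (f : reesAlgebra I) :
    π f = ∑ n ∈ (f : Polynomial R).support, of π n ⟨(f : Polynomial R).coeff n, f.2 n⟩ := by
  simp_rw [of_apply]
  rw [← map_sum]
  congr 1
  refine Subtype.ext ?_
  rw [AddSubmonoidClass.coe_finsetSum]
  exact (f : Polynomial R).as_sum_support

/-- An induction principle for raising the degree by one. The target is any additive subobject, so
that it serves both for ideals of `A` and for submodules of `A` over a polynomial ring. -/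
theorem of_succ_mem {S : Type*} [SetLike S A] [AddSubmonoidClass S A] {K : S} {L : Ideal R}
    (hL : L ≤ I) {n : ℕ}
    (h : ∀ q (hq : q ∈ L) (v : ↥(I ^ n)), degOne π ⟨q, hL hq⟩ * of π n v ∈ K)
    {w : R} (hw : w ∈ L * I ^ n) (hwI : w ∈ I ^ (n + 1)) : of π (n + 1) ⟨w, hwI⟩ ∈ K := by
  have hle : L * I ^ n ≤ I ^ (n + 1) := by
    rw [pow_succ']
    exact Ideal.mul_mono_left hL
  refine Submodule.mul_induction_on' (C := fun w _ => ∀ h : w ∈ I ^ (n + 1),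
    of π (n + 1) ⟨w, h⟩ ∈ K) ?_ ?_ hw hwI
  · intro q hq v hv _
    exact degOne_mul_of π ⟨q, hL hq⟩ ⟨v, hv⟩ ▸ h q hq ⟨v, hv⟩
  · intro x hx y hy ihx ihy _
    have := map_add (of π (n + 1)) ⟨x, hle hx⟩ ⟨y, hle hy⟩
    exact (congrArg (· ∈ K) this).mpr (add_mem (ihx (hle hx)) (ihy (hle hy)))

theorem of_succ_mem_of_mem_ofList_mul {S : Type*} [SetLike S A] [AddSubmonoidClass S A] {K : S}
    {as : List ↥I} {n : ℕ} (h : ∀ a ∈ as, ∀ v : ↥(I ^ n), degOne π a * of π n v ∈ K) {w : R}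
    (hw : w ∈ Ideal.ofList (as.map Subtype.val) * I ^ n) (hwI : w ∈ I ^ (n + 1)) :
    of π (n + 1) ⟨w, hwI⟩ ∈ K := by
  refine of_succ_mem π (ofList_map_val_le as) (fun q hq => ?_) hw hwI
  have hle := ofList_map_val_le as
  refine Submodule.span_induction (p := fun q hq => ∀ v : ↥(I ^ n),
    degOne π ⟨q, hle hq⟩ * of π n v ∈ K) ?_ ?_ ?_ ?_ hq
  · intro x hx v
    obtain ⟨a, ha, rfl⟩ := List.mem_map.mp hx
    exact h a ha v
  · intro v
    have : degOne π ⟨0, hle (zero_mem _)⟩ = 0 := map_zero (degOne π)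
    rw [this, zero_mul]
    exact zero_mem K
  · intro x y hx hy ihx ihy v
    have : degOne π ⟨x + y, hle (add_mem hx hy)⟩ = degOne π ⟨x, hle hx⟩ + degOne π ⟨y, hle hy⟩ :=
      map_add (degOne π) ⟨x, hle hx⟩ ⟨y, hle hy⟩
    rw [this, add_mul]
    exact add_mem (ihx v) (ihy v)
  · intro c x hx ihx v
    have : degOne π ⟨c • x, hle (Submodule.smul_mem _ c hx)⟩ = c • degOne π ⟨x, hle hx⟩ :=
      map_smul (degOne π) c ⟨x, hle hx⟩
    rw [this, smul_mul_assoc, ← mul_smul_comm, ← map_smul]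
    exact ihx (c • v)

end

namespace IsBlowup

variable {π : reesAlgebra I →ₐ[R] A} (hπ : IsBlowup 𝔞 π)
include hπ

theorem of_eq_zero_iff {n : ℕ} (u : ↥(I ^ n)) : of π n u = 0 ↔ (u : R) ∈ 𝔞 * I ^ n := by
  rw [of_apply, hπ.eq_zero_iff]
  refine ⟨fun h => by simpa [coe_reesMonomial] using h n, fun h m => ?_⟩
  rw [coe_reesMonomial]
  rcases eq_or_ne m n with rfl | hm
  · simpa using h
  · simp [Polynomial.coeff_monomial, hm.symm]

theorem of_mem_ofList {as : List ↥I} {n : ℕ} {u : ↥(I ^ n)}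
    (hu : (u : R) ∈ slice 𝔞 I (Ideal.ofList (as.map Subtype.val)) n) :
    of π n u ∈ Ideal.ofList (as.map (degOne π)) := by
  cases n with
  | zero =>
    have : of π 0 u = 0 := (hπ.of_eq_zero_iff u).mpr (by simpa [slice] using hu)
    exact this ▸ zero_mem _
  | succ n =>
    rw [slice] at hu
    obtain ⟨v, hv, w, hw, hvw⟩ := Submodule.mem_sup.mp hu
    have hle : Ideal.ofList (as.map Subtype.val) * I ^ n ≤ I ^ (n + 1) := by
      rw [pow_succ']
      exact Ideal.mul_mono_left (ofList_map_val_le as)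
    have hw' : of π (n + 1) ⟨w, hle hw⟩ ∈ Ideal.ofList (as.map (degOne π)) :=
      of_succ_mem_of_mem_ofList_mul π (fun a ha v => Ideal.mul_mem_right _ _
        (Ideal.subset_span (List.mem_map.mpr ⟨a, ha, rfl⟩))) hw _
    have hvI : v ∈ I ^ (n + 1) := Ideal.mul_le_right hv
    have h0 : of π (n + 1) ⟨v, hvI⟩ = 0 := (hπ.of_eq_zero_iff _).mpr hv
    have hadd := map_add (of π (n + 1)) ⟨v, hvI⟩ ⟨w, hle hw⟩
    rw [h0, zero_add] at hadd
    obtain ⟨u, hu'⟩ := u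
    subst hvw
    exact (congrArg (· ∈ Ideal.ofList (as.map (degOne π))) hadd).mpr hw'

/-- The ideal is generated by homogeneous elements, so membership is tested degree by degree. Two
lifts to the Rees algebra differ by coefficients in `𝔞 Iⁿ`, which `slice` already contains. -/
theorem map_mem_ofList_iff (as : List ↥I) (f : reesAlgebra I) :
    π f ∈ Ideal.ofList (as.map (degOne π)) ↔
      ∀ n, (f : Polynomial R).coeff n ∈
        slice 𝔞 I (Ideal.ofList (as.map Subtype.val)) n := by
  set Q := Ideal.ofList (as.map Subtype.val)
  constructor
  · intro hf
    have hle : Ideal.ofList (as.map (degOne π)) ≤ (sliceIdeal 𝔞 I Q).map π := by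
      refine Ideal.span_le.mpr fun z hz => ?_
      obtain ⟨a, ha, rfl⟩ := List.mem_map.mp hz
      rw [degOne_apply]
      refine Ideal.mem_map_of_mem _ fun n => ?_
      rw [coe_reesMonomial, Polynomial.coeff_monomial]
      split_ifs with hn
      · subst hn
        refine le_sup_right (a := 𝔞 * I ^ (0 + 1)) ?_
        rw [pow_zero, mul_one]
        exact Ideal.subset_span (List.mem_map.mpr ⟨a, ha, rfl⟩)
      · exact zero_mem _
    obtain ⟨g, hg, hgf⟩ := (Ideal.mem_map_iff_of_surjective π hπ.surjective).mp (hle hf)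
    intro n
    have h1 := (hπ.eq_zero_iff (g - f)).mp (by rw [map_sub, hgf, sub_self]) n
    have h2 := (slice 𝔞 I Q n).sub_mem (hg n) (mul_le_slice 𝔞 I Q n h1)
    simpa using h2
  · intro hf
    rw [map_eq_sum]
    exact Ideal.sum_mem _ fun n _ => hπ.of_mem_ofList (hf n)

theorem of_mem_ofList_iff (as : List ↥I) {n : ℕ} (u : ↥(I ^ n)) :
    of π n u ∈ Ideal.ofList (as.map (degOne π)) ↔
      (u : R) ∈ slice 𝔞 I (Ideal.ofList (as.map Subtype.val)) n := by
  refine ⟨fun h => ?_, hπ.of_mem_ofList⟩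
  rw [of_apply, hπ.map_mem_ofList_iff] at h
  simpa [coe_reesMonomial] using h n

end IsBlowup

/-- The degree one forms of a list of elements of `I` are regular on the homogeneous elements of
`⨁ₙ Iⁿ / 𝔞 Iⁿ`. -/
def FormRegular (𝔞 : Ideal R) (as : List ↥I) : Prop :=
  ∀ i (h : i < as.length) n, ∀ u ∈ I ^ n,
    (as[i] : R) * u ∈ slice 𝔞 I (Ideal.ofList ((as.take i).map Subtype.val)) (n + 1) →
      u ∈ slice 𝔞 I (Ideal.ofList ((as.take i).map Subtype.val)) n

theorem isWeaklyRegular_map_iff {X : Type*} (φ : X → A) (as : List X) :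
    RingTheory.Sequence.IsWeaklyRegular A (as.map φ) ↔
      ∀ i (h : i < as.length) z, φ as[i] * z ∈ Ideal.ofList ((as.take i).map φ) →
        z ∈ Ideal.ofList ((as.take i).map φ) := by
  rw [RingTheory.Sequence.isWeaklyRegular_iff]
  simp_rw [isSMulRegular_quotient_iff_mem_of_smul_mem]
  simp [← List.map_take]

/-- Multiplication by a degree one form shifts degrees by one and the ideals involved are
homogeneous, so regularity needs testing on homogeneous elements only. -/
theorem IsBlowup.isWeaklyRegular_iff {π : reesAlgebra I →ₐ[R] A} (hπ : IsBlowup 𝔞 π)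
    (as : List ↥I) :
    RingTheory.Sequence.IsWeaklyRegular A (as.map (degOne π)) ↔ FormRegular 𝔞 as := by
  rw [isWeaklyRegular_map_iff]
  constructor
  · intro H i h n u hu hau
    have := H i h (of π n ⟨u, hu⟩)
    rw [degOne_mul_of, hπ.of_mem_ofList_iff, hπ.of_mem_ofList_iff] at this
    exact this hau
  · intro H i h z
    obtain ⟨f, rfl⟩ := hπ.surjective z
    rw [degOne_apply, ← map_mul, hπ.map_mem_ofList_iff, hπ.map_mem_ofList_iff]
    intro hf n
    refine H i (by simpa using h) n _ (f.2 n) ?_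
    have := hf (n + 1)
    rwa [Subalgebra.coe_mul, coe_reesMonomial, ← Polynomial.C_mul_X_eq_monomial, mul_assoc,
      Polynomial.coeff_C_mul, Polynomial.coeff_X_mul] at this

end Blowup

/-! ### Valabrega–Valla type criteria for regularity of forms. -/

namespace Blowup

variable {R : Type*} [CommRing R] {𝔞 I : Ideal R}

theorem ofList_take_succ (as : List ↥I) {i : ℕ} (h : i < as.length) :
    Ideal.ofList ((as.take (i + 1)).map Subtype.val) =
      Ideal.ofList ((as.take i).map Subtype.val) ⊔ Ideal.span {(as[i] : R)} := by
  rw [List.take_succ_eq_append_getElem h, List.map_append, Ideal.ofList_append]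
  simp

theorem mem_mul_of_mem_span_mul {K L : Ideal R} {a x : R}
    (hx : x ∈ (K ⊔ Ideal.span {a}) * L) : ∃ q ∈ K * L, ∃ b ∈ L, q + a * b = x := by
  rw [Ideal.sup_mul] at hx
  obtain ⟨q, hq, y, hy, rfl⟩ := Submodule.mem_sup.mp hx
  obtain ⟨b, hb, rfl⟩ := Ideal.mem_span_singleton_mul.mp hy
  exact ⟨q, hq, b, hb, rfl⟩

/-- The Valabrega–Valla criterion, in the direction from regularity of the initial forms. -/
theorem FormRegular.ofList_inf_pow_le {as : List ↥I} (H : FormRegular I as) :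
    ∀ i ≤ as.length, ∀ n, Ideal.ofList ((as.take i).map Subtype.val) ⊓ I ^ (n + 1) ≤
      Ideal.ofList ((as.take i).map Subtype.val) * I ^ n := by
  intro i
  induction i with
  | zero => intro _ n; simp
  | succ i ih =>
    intro hi n
    have hi' : i < as.length := hi
    specialize ih hi'.le
    rw [ofList_take_succ as hi']
    set Q := Ideal.ofList ((as.take i).map Subtype.val) with hQ
    set a := as[i] with ha
    have hQI : Q ≤ I := ofList_map_val_le _
    intro w hw
    obtain ⟨hwQ, hwI⟩ := hw
    -- Raise the exponent one step at a time. Writing `w = q + a b`, regularity of the form of `a`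
    -- splits `b = b₁ + b₂` with `a b₁ ∈ Q Iʲ` and `b₂ ∈ Iʲ⁺¹`; then `q + a b₁` lies in `Q ∩ Iʲ⁺²`,
    -- which the induction on `i` handles.
    have key : ∀ j ≤ n, w ∈ (Q ⊔ Ideal.span {(a : R)}) * I ^ j := by
      intro j
      induction j with
      | zero => intro _; simpa using hwQ
      | succ j ihj =>
        intro hj
        obtain ⟨q, hq, b, hb, rfl⟩ := mem_mul_of_mem_span_mul (ihj (by omega))
        have hw2 : q + a * b ∈ I ^ (j + 2) := Ideal.pow_le_pow_right (by omega) hwI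
        have hb' : b ∈ slice I I Q j := by
          refine H i hi' j b hb ?_
          rw [← ha, ← hQ, slice]
          have : (a : R) * b = (q + a * b) - q := by ring
          rw [this]
          refine sub_mem (Ideal.mem_sup_left ?_) (Ideal.mem_sup_right hq)
          rwa [← pow_succ']
        obtain ⟨b₁, hb₁, b₂, hb₂, rfl⟩ :
            ∃ b₁, (a : R) * b₁ ∈ Q * I ^ j ∧ ∃ b₂ ∈ I ^ (j + 1), b₁ + b₂ = b := by
          cases j with
          | zero => exact ⟨0, by simp, b, by simpa [slice] using hb', by simp⟩
          | succ j =>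
            obtain ⟨x, hx, y, hy, rfl⟩ := Submodule.mem_sup.mp hb'
            refine ⟨y, ?_, x, by rwa [pow_succ'], add_comm _ _⟩
            have := Ideal.mul_mem_mul a.2 hy
            rwa [mul_left_comm, ← pow_succ'] at this
        have hq' : q + a * b₁ ∈ Q * I ^ (j + 1) := by
          refine ih (j + 1) ⟨Ideal.mul_le_left (add_mem hq hb₁), ?_⟩
          have : q + (a : R) * b₁ = (q + a * (b₁ + b₂)) - a * b₂ := by ring
          rw [this]
          refine sub_mem hw2 ?_
          rw [pow_succ' I (j + 1)]
          exact Ideal.mul_mem_mul a.2 hb₂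
        have : q + (a : R) * (b₁ + b₂) = (q + a * b₁) + a * b₂ := by ring
        rw [this, Ideal.sup_mul]
        exact add_mem (Ideal.mem_sup_left hq')
          (Ideal.mem_sup_right (Ideal.mul_mem_mul (Ideal.mem_span_singleton_self _) hb₂))
    exact key n le_rfl

section

variable {as : List ↥I} (hreg : ∀ i (h : i < as.length) (u : R),
    as[i] * u ∈ Ideal.ofList ((as.take i).map Subtype.val) →
      u ∈ Ideal.ofList ((as.take i).map Subtype.val))
  (hVV : ∀ i < as.length, ∀ n, Ideal.ofList ((as.take i).map Subtype.val) ⊓ I ^ (n + 1) ≤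
      Ideal.ofList ((as.take i).map Subtype.val) * I ^ n)
  (hI : I ≤ 𝔞)
include hreg hVV hI

/-- Descending induction drops one generator `a` at a time. An element of the intersection for `Q`
is `q + a b` with `q ∈ 𝔞 Q Iⁿ`, `b ∈ 𝔞 Iⁿ`. Then `a b ∈ Q`, so `b ∈ Q` by regularity in `R`, `b ∈ Q
Iⁿ⁻¹` by `hVV`, and the case `n - 1` gives `b ∈ 𝔞 Q Iⁿ⁻¹`. For `n = 0`, `a ∈ I ⊆ 𝔞` suffices. -/
theorem ofList_mul_inf_le (hstar : ∀ n, Ideal.ofList (as.map Subtype.val) * I ^ n ⊓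
      𝔞 * I ^ (n + 1) ≤ 𝔞 * (Ideal.ofList (as.map Subtype.val) * I ^ n)) :
    ∀ i ≤ as.length, ∀ n, Ideal.ofList ((as.take i).map Subtype.val) * I ^ n ⊓
      𝔞 * I ^ (n + 1) ≤ 𝔞 * (Ideal.ofList ((as.take i).map Subtype.val) * I ^ n) := by
  intro i hi
  induction hi using Nat.decreasingInduction with
  | self => simpa using hstar
  | of_succ i hi ih =>
    rw [ofList_take_succ as hi] at ih
    specialize hreg i hi
    specialize hVV i hi
    set Q := Ideal.ofList ((as.take i).map Subtype.val) with hQ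
    set a := as[i] with ha
    have hQI : Q ≤ I := ofList_map_val_le _
    intro n
    induction n with
    | zero =>
      rintro w ⟨hwQ, hwI⟩
      obtain ⟨q, hq, b, hb, rfl⟩ : ∃ q ∈ 𝔞 * (Q * I ^ 0), ∃ b ∈ 𝔞 * I ^ 0, q + a * b = w := by
        have := ih 0 ⟨Ideal.mul_mono_left le_sup_left hwQ, hwI⟩
        rw [mul_left_comm] at this
        obtain ⟨q, hq, b, hb, rfl⟩ := mem_mul_of_mem_span_mul this
        exact ⟨q, by rwa [mul_left_comm], b, hb, rfl⟩
      refine add_mem hq ?_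
      have hb' : b ∈ Q := by
        refine hreg b ?_
        have : (a : R) * b = (q + a * b) - q := by ring
        rw [this]
        exact sub_mem (Ideal.mul_le_left hwQ) (Ideal.mul_le_left (Ideal.mul_le_right hq))
      rw [pow_zero, mul_one]
      exact Ideal.mul_mem_mul (hI a.2) hb'
    | succ n ihn =>
      rintro w ⟨hwQ, hwI⟩
      obtain ⟨q, hq, b, hb, rfl⟩ :
          ∃ q ∈ 𝔞 * (Q * I ^ (n + 1)), ∃ b ∈ 𝔞 * I ^ (n + 1), q + a * b = w := by
        have := ih (n + 1) ⟨Ideal.mul_mono_left le_sup_left hwQ, hwI⟩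
        rw [mul_left_comm] at this
        obtain ⟨q, hq, b, hb, rfl⟩ := mem_mul_of_mem_span_mul this
        exact ⟨q, by rwa [mul_left_comm], b, hb, rfl⟩
      refine add_mem hq ?_
      have hb' : b ∈ Q := by
        refine hreg b ?_
        have : (a : R) * b = (q + a * b) - q := by ring
        rw [this]
        exact sub_mem (Ideal.mul_le_left hwQ) (Ideal.mul_le_left (Ideal.mul_le_right hq))
      have hb'' := ihn ⟨hVV n ⟨hb', Ideal.mul_le_right hb⟩, hb⟩
      have := Ideal.mul_mem_mul a.2 hb''
      rwa [mul_left_comm, mul_left_comm I, ← pow_succ'] at this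

/-- If `a u = w + q` with `w ∈ 𝔞 Iⁿ⁺¹`, `q ∈ Q Iⁿ`, the preceding lemma gives `w = q' + a b` with `b
∈ 𝔞 Iⁿ`. Then `a (u - b) ∈ Q`, so `u - b ∈ Q ∩ Iⁿ`, which `hVV` controls. Only proper truncations
enter `hVV`, which is why depth `d - 1` is enough. -/
theorem formRegular_of_inf_le (hstar : ∀ n, Ideal.ofList (as.map Subtype.val) * I ^ n ⊓
      𝔞 * I ^ (n + 1) ≤ 𝔞 * (Ideal.ofList (as.map Subtype.val) * I ^ n)) :
    FormRegular 𝔞 as := by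
  intro i hi n u hu hau
  have hle := ofList_mul_inf_le hreg hVV hI hstar (i + 1) hi n
  rw [ofList_take_succ as hi] at hle
  specialize hreg i hi
  specialize hVV i hi
  set Q := Ideal.ofList ((as.take i).map Subtype.val) with hQ
  set a := as[i] with ha
  have hQI : Q ≤ I := ofList_map_val_le _
  obtain ⟨w, hw, q, hq, hwq⟩ := Submodule.mem_sup.mp hau
  have hw' : w ∈ (Q ⊔ Ideal.span {(a : R)}) * (𝔞 * I ^ n) := by
    rw [mul_left_comm]
    refine hle ⟨?_, hw⟩
    have : w = a * u - q := by rw [← hwq]; ring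
    rw [this, Ideal.sup_mul]
    exact sub_mem (Ideal.mem_sup_right (Ideal.mul_mem_mul (Ideal.mem_span_singleton_self _) hu))
      (Ideal.mem_sup_left hq)
  obtain ⟨q', hq', b, hb, rfl⟩ := mem_mul_of_mem_span_mul hw'
  have hub : u - b ∈ Q := by
    refine hreg _ ?_
    have : (a : R) * (u - b) = q' + q := by rw [mul_sub, ← hwq]; ring
    rw [this]
    exact add_mem (Ideal.mul_le_left hq') (Ideal.mul_le_left hq)
  cases n with
  | zero =>
    have : u = (u - b) + b := by ring
    rw [this]
    exact add_mem (hI (hQI hub)) (Ideal.mul_le_left hb)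
  | succ n =>
    have : u = b + (u - b) := by ring
    rw [this]
    exact add_mem (Ideal.mem_sup_left hb)
      (Ideal.mem_sup_right (hVV n ⟨hub, sub_mem hu (Ideal.mul_le_right hb)⟩))

end

/-- Induction on the generators. In `q + a c`, regularity in degree one writes `c` as an element of
`𝔞 I` plus some `c₂ ∈ Q`, and `a c₂` is absorbed into the part coming from earlier generators. -/
theorem FormRegular.inf_le {as : List ↥I} (H : FormRegular 𝔞 as) :
    𝔞 * I ^ 2 ⊓ Ideal.ofList (as.map Subtype.val) * I ≤
      𝔞 * (I * Ideal.ofList (as.map Subtype.val)) := by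
  have key : ∀ i ≤ as.length, 𝔞 * I ^ 2 ⊓ Ideal.ofList ((as.take i).map Subtype.val) * I ≤
      𝔞 * (I * Ideal.ofList ((as.take i).map Subtype.val)) := by
    intro i
    induction i with
    | zero => simp
    | succ i ih =>
      intro hi
      have hi' : i < as.length := hi
      specialize ih hi'.le
      specialize H i hi' 1
      rw [ofList_take_succ as hi']
      set Q := Ideal.ofList ((as.take i).map Subtype.val) with hQ
      set a := as[i] with ha
      rintro w ⟨hwI, hwQ⟩
      obtain ⟨q, hq, c, hc, rfl⟩ := mem_mul_of_mem_span_mul hwQ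
      have hc' : c ∈ slice 𝔞 I Q 1 := by
        refine H c (by simpa using hc) ?_
        have : (a : R) * c = (q + a * c) - q := by ring
        rw [this]
        refine sub_mem (Ideal.mem_sup_left hwI) (Ideal.mem_sup_right (by simpa using hq))
      obtain ⟨c₁, hc₁, c₂, hc₂, rfl⟩ := Submodule.mem_sup.mp hc'
      simp only [zero_add, pow_one, pow_zero, mul_one] at hc₁ hc₂
      have hac₁ : (a : R) * c₁ ∈ 𝔞 * (I * Ideal.span {(a : R)}) := by
        rw [mul_comm (a : R), ← mul_assoc]
        exact Ideal.mul_mem_mul hc₁ (Ideal.mem_span_singleton_self _)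
      have hle : Ideal.span {(a : R)} ≤ I := (Ideal.span_singleton_le_iff_mem _).mpr a.2
      have h2 : q + a * c₂ ∈ 𝔞 * (I * Q) := by
        refine ih ⟨?_, ?_⟩
        · have : q + (a : R) * c₂ = (q + a * (c₁ + c₂)) - a * c₁ := by ring
          rw [this]
          refine sub_mem hwI ?_
          rw [pow_two]
          exact Ideal.mul_mono_right (Ideal.mul_mono_right hle) hac₁
        · refine add_mem hq ?_
          rw [mul_comm]
          exact Ideal.mul_mem_mul a.2 hc₂
      have : q + (a : R) * (c₁ + c₂) = (q + a * c₂) + a * c₁ := by ring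
      rw [this]
      exact add_mem (Ideal.mul_mono_right (Ideal.mul_mono_right le_sup_left) h2)
        (Ideal.mul_mono_right (Ideal.mul_mono_right le_sup_right) hac₁)
  simpa using key as.length le_rfl

end Blowup

/-! ### Generic elements over an infinite residue field. -/

section Avoidance

/-- A finite module over a local ring with infinite residue field is not a finite union of proper
submodules. -/
theorem IsLocalRing.exists_forall_notMem_submodule {R M : Type*} [CommRing R] [IsLocalRing R]
    [Infinite (ResidueField R)] [AddCommGroup M] [Module R M] [Module.Finite R M]
    (s : Finset (Submodule R M)) (hs : ⊤ ∉ s) : ∃ a : M, ∀ N ∈ s, a ∉ N := by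
  classical
  let _ : Field (R ⧸ maximalIdeal R) := Ideal.Quotient.field _
  have : Infinite (R ⧸ maximalIdeal R) := ‹Infinite (ResidueField R)›
  let V := M ⧸ (maximalIdeal R • ⊤ : Submodule R M)
  let q : M →ₗ[R] V := (maximalIdeal R • ⊤ : Submodule R M).mkQ
  -- Reduce modulo `𝔪` to a vector space over the infinite residue field; Nakayama keeps the images
  -- proper.
  let f : Submodule R M → Submodule (R ⧸ maximalIdeal R) V := fun N =>
    { carrier := N.map q
      add_mem' := (N.map q).add_mem
      zero_mem' := (N.map q).zero_mem
      smul_mem' := by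
        intro c x hx
        obtain ⟨r, rfl⟩ := Ideal.Quotient.mk_surjective c
        have : Ideal.Quotient.mk (maximalIdeal R) r • x = r • x :=
          algebraMap_smul (R ⧸ maximalIdeal R) r x
        rw [this]
        exact (N.map q).smul_mem r hx }
  have hf : ∀ N, N ≠ ⊤ → f N ≠ ⊤ := by
    intro N hN h
    refine hN ?_
    have h1 : N.map q = ⊤ := by
      ext x
      refine ⟨fun _ => trivial, fun _ => ?_⟩
      have : x ∈ f N := h ▸ trivial
      exact this
    have h2 : ⊤ ≤ N ⊔ maximalIdeal R • (⊤ : Submodule R M) := by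
      have := (Submodule.comap_map_eq q N).symm
      rw [h1, Submodule.comap_top, Submodule.ker_mkQ] at this
      exact this.ge
    exact top_le_iff.mp (Submodule.le_of_le_smul_of_le_jacobson_bot Module.Finite.fg_top
      (maximalIdeal_le_jacobson ⊥) h2)
  have := Subspace.biUnion_ne_univ_of_top_notMem (s := s.image f) (by
    intro h
    obtain ⟨N, hN, hN'⟩ := Finset.mem_image.mp h
    exact hf N (fun h => hs (h ▸ hN)) hN')
  obtain ⟨x, hx⟩ := (Set.ne_univ_iff_exists_notMem _).mp this
  obtain ⟨a, rfl⟩ := Submodule.mkQ_surjective _ x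
  refine ⟨a, fun N hN ha => hx ?_⟩
  simp only [Set.mem_iUnion]
  exact ⟨f N, Finset.mem_image_of_mem f hN, ⟨a, ha, rfl⟩⟩

end Avoidance

theorem List.take_dropLast_length_sub {X : Type*} (l : List X) (k : ℕ) :
    l.dropLast.take (l.dropLast.length - k) = l.take (l.length - (k + 1)) := by
  rw [List.dropLast_eq_take, List.take_take, List.length_take]
  congr 1
  omega

/-! ### Replacing regular sequences by generic ones. -/

namespace RingTheory.Sequence

open scoped Pointwise

/-- The only point is that `r` is regular modulo `a`: if `r x = a y`, then `y = r z`, and cancelling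
`r` gives `x = a z`. No locality is needed. -/
theorem IsWeaklyRegular.swap_of_isSMulRegular {A M : Type*} [CommRing A] [AddCommGroup M]
    [Module A M] {r a : A} {rs : List A} (h : IsWeaklyRegular M (r :: a :: rs))
    (ha : IsSMulRegular M a) : IsWeaklyRegular M (a :: r :: rs) := by
  have h' : IsWeaklyRegular M ([r, a] ++ rs) := h
  have hgoal : IsWeaklyRegular M ([a, r] ++ rs) := by
    rw [isWeaklyRegular_append_iff] at h' ⊢
    have e : Ideal.ofList [a, r] = Ideal.ofList [r, a] := by
      simp [sup_comm]
    refine ⟨?_, e ▸ h'.2⟩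
    have h1 := h'.1
    simp only [isWeaklyRegular_cons_iff, IsWeaklyRegular.nil, and_true] at h1 ⊢
    refine ⟨ha, ?_⟩
    have h2 := h1.2
    rw [isSMulRegular_quotient_iff_mem_of_smul_mem] at h2 ⊢
    intro x hx
    obtain ⟨y, -, hy⟩ := (Submodule.mem_smul_pointwise_iff_exists _ _ _).mp hx
    have hy' : y ∈ r • (⊤ : Submodule A M) :=
      h2 y ((Submodule.mem_smul_pointwise_iff_exists _ _ _).mpr ⟨x, trivial, hy.symm⟩)
    obtain ⟨z, -, rfl⟩ := (Submodule.mem_smul_pointwise_iff_exists _ _ _).mp hy'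
    refine (Submodule.mem_smul_pointwise_iff_exists _ _ _).mpr ⟨z, trivial, h1.1 ?_⟩
    change r • a • z = r • x
    rw [← hy, smul_comm]
  exact hgoal

variable {R J A : Type*} [CommRing R] [AddCommGroup J] [Module R J] [CommRing A] [Algebra R A]

/-- The image under `φ` of a generic element of `J` is regular on a module of positive grade. -/
theorem exists_finset_isSMulRegular [IsNoetherianRing A] (φ : J →ₗ[R] A) {𝔐 : Ideal A}
    (h𝔐 : ∀ P : Ideal A, P.IsPrime → (∀ a, φ a ∈ P) → 𝔐 ≤ P)
    (M : Type*) [AddCommGroup M] [Module A M] [Module.Finite A M] {r : A} (hr : r ∈ 𝔐)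
    (hreg : IsSMulRegular M r) :
    ∃ s : Finset (Submodule R J), ⊤ ∉ s ∧ ∀ a, (∀ N ∈ s, a ∉ N) → IsSMulRegular M (φ a) := by
  classical
  have hfin := associatedPrimes.finite A M
  -- The submodules to avoid are preimages of associated primes of `M`. If one were all of `J`, that
  -- prime would contain `𝔐` and hence the regular element `r`.
  let g : Ideal A → Submodule R J := fun P => (P.restrictScalars R).comap φ
  have hcompl := biUnion_associatedPrimes_eq_compl_regular A M
  refine ⟨hfin.toFinset.image g, ?_, fun a ha => ?_⟩
  · intro h
    obtain ⟨P, hP, hPtop⟩ := Finset.mem_image.mp h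
    have hP' : P ∈ associatedPrimes A M := hfin.mem_toFinset.mp hP
    have hle := h𝔐 P hP'.1 (fun a => by
      have : a ∈ g P := hPtop ▸ trivial
      exact this)
    have : r ∈ ⋃ p ∈ associatedPrimes A M, (p : Set A) := by
      simp only [Set.mem_iUnion]
      exact ⟨P, hP', hle hr⟩
    rw [hcompl] at this
    exact this hreg
  · by_contra hnot
    have : φ a ∈ ⋃ p ∈ associatedPrimes A M, (p : Set A) := by
      rw [hcompl]
      exact hnot
    simp only [Set.mem_iUnion] at this
    obtain ⟨P, hP, haP⟩ := this
    exact ha (g P) (Finset.mem_image_of_mem g (hfin.mem_toFinset.mpr hP)) haP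

/-- A generic `φ a` can be put in front at the cost of the last entry: by induction it can be
inserted after `r`, and since it is also regular on `M` it can be swapped with `r`. -/
theorem exists_finset_isWeaklyRegular [IsNoetherianRing A] (φ : J →ₗ[R] A) {𝔐 : Ideal A}
    (h𝔐 : ∀ P : Ideal A, P.IsPrime → (∀ a, φ a ∈ P) → 𝔐 ≤ P) (rs : List A) :
    ∀ (M : Type*) [AddCommGroup M] [Module A M] [Module.Finite A M], rs ≠ [] →
    (∀ r ∈ rs, r ∈ 𝔐) → IsWeaklyRegular M rs →
    ∃ s : Finset (Submodule R J), ⊤ ∉ s ∧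
      ∀ a, (∀ N ∈ s, a ∉ N) → IsWeaklyRegular M (φ a :: rs.dropLast) := by
  classical
  induction rs with
  | nil => intro M _ _ _ h; exact absurd rfl h
  | cons r rs ih =>
    intro M _ _ _ _ hrs hreg
    rw [isWeaklyRegular_cons_iff] at hreg
    obtain ⟨s, hs, hsreg⟩ := exists_finset_isSMulRegular φ h𝔐 M (hrs r (by simp)) hreg.1
    rcases eq_or_ne rs [] with rfl | hne
    · refine ⟨s, hs, fun a ha => ?_⟩
      simpa using hsreg a ha
    · obtain ⟨s', hs', hsreg'⟩ := ih (QuotSMulTop r M) hne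
        (fun x hx => hrs x (List.mem_cons_of_mem _ hx)) hreg.2
      refine ⟨s ∪ s', by simp [hs, hs'], fun a ha => ?_⟩
      rw [List.dropLast_cons_of_ne_nil hne]
      refine IsWeaklyRegular.swap_of_isSMulRegular (IsWeaklyRegular.cons hreg.1 ?_)
        (hsreg a fun N hN => ha N (Finset.mem_union_left _ hN))
      exact hsreg' a fun N hN => ha N (Finset.mem_union_right _ hN)

/-- Simultaneous replacement of the first `k` elements of weakly regular sequences on two modules
by images of common elements of `J`. -/
theorem exists_isWeaklyRegular_map_append [IsLocalRing R] [Infinite (ResidueField R)]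
    [Module.Finite R J] {B : Type*} [CommRing B] [Algebra R B]
    [IsNoetherianRing A] [IsNoetherianRing B] (φ : J →ₗ[R] A) (ψ : J →ₗ[R] B)
    {𝔐 : Ideal A} (h𝔐 : ∀ P : Ideal A, P.IsPrime → (∀ a, φ a ∈ P) → 𝔐 ≤ P)
    {𝔑 : Ideal B} (h𝔑 : ∀ P : Ideal B, P.IsPrime → (∀ a, ψ a ∈ P) → 𝔑 ≤ P) (k : ℕ) :
    ∀ (M : Type*) [AddCommGroup M] [Module A M] [Module.Finite A M]
      (N : Type*) [AddCommGroup N] [Module B N] [Module.Finite B N]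
      (rs : List A) (ts : List B), (∀ r ∈ rs, r ∈ 𝔐) → (∀ t ∈ ts, t ∈ 𝔑) →
      k ≤ rs.length → k ≤ ts.length → IsWeaklyRegular M rs → IsWeaklyRegular N ts →
      ∃ as : List J, as.length = k ∧
        IsWeaklyRegular M (as.map φ ++ rs.take (rs.length - k)) ∧
        IsWeaklyRegular N (as.map ψ ++ ts.take (ts.length - k)) := by
  classical
  induction k with
  | zero =>
    intro M _ _ _ N _ _ _ rs ts _ _ _ _ hM hN
    exact ⟨[], rfl, by simpa using hM, by simpa using hN⟩
  | succ k ih =>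
    intro M _ _ _ N _ _ _ rs ts hrs hts hk hk' hM hN
    have hrs0 : rs ≠ [] := List.ne_nil_of_length_pos (by omega)
    have hts0 : ts ≠ [] := List.ne_nil_of_length_pos (by omega)
    obtain ⟨s, hs, hs'⟩ := exists_finset_isWeaklyRegular φ h𝔐 rs M hrs0 hrs hM
    obtain ⟨t, ht, ht'⟩ := exists_finset_isWeaklyRegular ψ h𝔑 ts N hts0 hts hN
    obtain ⟨a, ha⟩ := IsLocalRing.exists_forall_notMem_submodule (s ∪ t) (by simp [hs, ht])
    have h1 := hs' a fun L hL => ha L (Finset.mem_union_left _ hL)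
    have h2 := ht' a fun L hL => ha L (Finset.mem_union_right _ hL)
    rw [isWeaklyRegular_cons_iff] at h1 h2
    obtain ⟨as, has, h3, h4⟩ := ih (QuotSMulTop (φ a) M) (QuotSMulTop (ψ a) N)
      rs.dropLast ts.dropLast (fun r hr => hrs r (List.mem_of_mem_dropLast hr))
      (fun r hr => hts r (List.mem_of_mem_dropLast hr))
      (by rw [List.length_dropLast]; omega) (by rw [List.length_dropLast]; omega) h1.2 h2.2
    rw [List.take_dropLast_length_sub] at h3 h4
    exact ⟨a :: as, by simp [has], IsWeaklyRegular.cons h1.1 h3, IsWeaklyRegular.cons h2.1 h4⟩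

end RingTheory.Sequence

/-! ### The irrelevant ideal and generic elements of a reduction. -/

namespace Blowup

variable {R : Type*} [CommRing R] {𝔞 I : Ideal R} {A : Type*} [CommRing A] [Algebra R A]

theorem of_zero_apply (π : reesAlgebra I →ₐ[R] A) (u : ↥(I ^ 0)) :
    of π 0 u = algebraMap R A u := π.commutes u.1

theorem degOne_pow (π : reesAlgebra I →ₐ[R] A) (u : ↥I) (k : ℕ) :
    degOne π u ^ k = of π k ⟨u ^ k, Ideal.pow_mem_pow u.2 k⟩ := by
  induction k with
  | zero =>
    rw [of_zero_apply]
    simp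
  | succ k ih =>
    rw [pow_succ', ih, degOne_mul_of]
    simp only [pow_succ']

theorem mem_reesIrrelevantIdeal [IsLocalRing R] {f : reesAlgebra I} :
    f ∈ reesIrrelevantIdeal I ↔ (f : Polynomial R).coeff 0 ∈ maximalIdeal R := Iff.rfl

theorem of_succ_mem_map_irrelevant [IsLocalRing R] (π : reesAlgebra I →ₐ[R] A) {n : ℕ}
    (u : ↥(I ^ (n + 1))) : of π (n + 1) u ∈ (reesIrrelevantIdeal I).map π :=
  Ideal.mem_map_of_mem _ (by
    rw [mem_reesIrrelevantIdeal, coe_reesMonomial, Polynomial.coeff_monomial_of_ne _ (by simp)]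
    exact zero_mem _)

theorem degOne_mem_map_irrelevant [IsLocalRing R] (π : reesAlgebra I →ₐ[R] A) (u : ↥I) :
    degOne π u ∈ (reesIrrelevantIdeal I).map π :=
  of_succ_mem_map_irrelevant π (n := 0) _

theorem of_mem_map_irrelevant_pow [IsLocalRing R] (π : reesAlgebra I →ₐ[R] A) {n : ℕ} :
    ∀ u : ↥(I ^ n), of π n u ∈ ((reesIrrelevantIdeal I).map π) ^ n := by
  induction n with
  | zero => simp
  | succ n ih =>
    rintro ⟨u, hu⟩
    refine of_succ_mem π le_rfl (fun q hq v => ?_) (by rwa [← pow_succ']) hu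
    rw [pow_succ']
    exact Ideal.mul_mem_mul (degOne_mem_map_irrelevant π _) (ih v)

/-- Verifies the hypothesis of the genericity lemmas. A prime containing the forms of `J` contains
the `(n₀ + 1)`-st power of every degree one form, hence the form itself; in degree zero, elements of
`𝔪` become nilpotent because a power lies in `I ⊆ 𝔞`. -/
theorem IsBlowup.map_irrelevant_le [IsLocalRing R] {π : reesAlgebra I →ₐ[R] A}
    (hπ : IsBlowup 𝔞 π) (hI𝔞 : I ≤ 𝔞) (hI : maximalIdeal R ≤ I.radical) {J : Ideal R} (hJI : J ≤ I)
    {n₀ : ℕ} (hred : I ^ (n₀ + 1) = J * I ^ n₀) {P : Ideal A} (hP : P.IsPrime)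
    (hJP : ∀ a : ↥J, (degOne π ∘ₗ Submodule.inclusion hJI) a ∈ P) :
    (reesIrrelevantIdeal I).map π ≤ P := by
  have h1 : ∀ u : ↥I, degOne π u ∈ P := by
    intro u
    refine hP.mem_of_pow_mem (n₀ + 1) ?_
    rw [degOne_pow]
    have hu : (u : R) ^ (n₀ + 1) ∈ J * I ^ n₀ := hred ▸ Ideal.pow_mem_pow u.2 _
    exact of_succ_mem π hJI (fun q hq v => Ideal.mul_mem_right _ _ (hJP ⟨q, hq⟩)) hu _
  refine Ideal.map_le_iff_le_comap.mpr fun f hf => ?_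
  rw [Ideal.mem_comap]
  rw [map_eq_sum]
  refine Ideal.sum_mem _ fun n _ => ?_
  cases n with
  | zero =>
    obtain ⟨k, hk⟩ := hI (mem_reesIrrelevantIdeal.mp hf)
    refine hP.mem_of_pow_mem k ?_
    rw [of_zero_apply, ← map_pow]
    have := (hπ.of_eq_zero_iff (n := 0) ⟨_, by simp⟩).mpr (by simpa using hI𝔞 hk)
    rw [of_zero_apply] at this
    simp only at this ⊢
    rw [this]
    exact zero_mem _
  | succ n =>
    refine of_succ_mem π le_rfl (fun q hq v => Ideal.mul_mem_right _ _ (h1 _)) ?_ _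
    rw [← pow_succ']
    exact f.2 (n + 1)

/-- The canonical presentation of `BlowupQuotient 𝔞 I`. -/
noncomputable def blowupMk (𝔞 I : Ideal R) :
    @AlgHom R (reesAlgebra I) (BlowupQuotient 𝔞 I) _ _
      (CommRing.toCommSemiring (α := BlowupQuotient 𝔞 I)).toSemiring _ _ :=
  Ideal.Quotient.mkₐ R (reesCoeffIdeal 𝔞 I)

theorem isBlowup_blowupMk (𝔞 I : Ideal R) :
    IsBlowup (A := BlowupQuotient 𝔞 I) 𝔞 (blowupMk 𝔞 I) where
  surjective := Ideal.Quotient.mk_surjective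
  eq_zero_iff _ := Ideal.Quotient.eq_zero_iff_mem

/-- A generic element of a reduction acts injectively on the fiber cone in large degrees. -/
theorem IsBlowup.exists_finset_forall_mem [IsLocalRing R]
    [IsNoetherianRing A] {π : reesAlgebra I →ₐ[R] A}
    (hπ : IsBlowup 𝔞 π) (hI𝔞 : I ≤ 𝔞) (hI : maximalIdeal R ≤ I.radical) {J : Ideal R} (hJI : J ≤ I)
    {n₀ : ℕ} (hred : I ^ (n₀ + 1) = J * I ^ n₀) :
    ∃ s : Finset (Submodule R J), ⊤ ∉ s ∧ ∃ k, ∀ a : ↥J, (∀ N ∈ s, a ∉ N) →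
      ∀ n ≥ k, ∀ u ∈ I ^ n, (a : R) * u ∈ 𝔞 * I ^ (n + 1) → u ∈ 𝔞 * I ^ n := by
  classical
  -- Take a primary decomposition of zero. Components whose radical contains `𝔐` contain everything
  -- of large degree; the radicals of the others are avoided by the form of a generic `a`.
  obtain ⟨t, ht, htprim⟩ := Submodule.isLasker A A ⊥
  let 𝔐 := (reesIrrelevantIdeal I).map π
  let φ := degOne π ∘ₗ Submodule.inclusion hJI
  let g : Ideal A → Submodule R J := fun q => (q.radical.restrictScalars R).comap φ
  have hk : ∃ k, ∀ q ∈ t, 𝔐 ≤ Ideal.radical q → 𝔐 ^ k ≤ q := by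
    have hex : ∀ q : Ideal A, ∃ k, 𝔐 ≤ Ideal.radical q → 𝔐 ^ k ≤ q := by
      intro q
      by_cases h : 𝔐 ≤ Ideal.radical q
      · obtain ⟨k, hk⟩ := Ideal.exists_pow_le_of_le_radical_of_fg h (IsNoetherian.noetherian _)
        exact ⟨k, fun _ => hk⟩
      · exact ⟨0, fun h' => absurd h' h⟩
    choose k hk using hex
    exact ⟨t.sup k, fun q hq h => (Ideal.pow_le_pow_right (Finset.le_sup hq)).trans (hk q h)⟩
  obtain ⟨k, hk⟩ := hk
  refine ⟨(t.filter fun q => ¬ 𝔐 ≤ Ideal.radical q).image g, ?_, k, ?_⟩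
  · intro h
    obtain ⟨q, hq, hqtop⟩ := Finset.mem_image.mp h
    obtain ⟨hqt, hq𝔐⟩ := Finset.mem_filter.mp hq
    have hprim : Ideal.IsPrimary q := htprim hqt
    refine hq𝔐 (hπ.map_irrelevant_le hI𝔞 hI hJI hred (Ideal.isPrime_radical hprim) fun a => ?_)
    have : a ∈ g q := hqtop ▸ trivial
    exact this
  · intro a ha n hn u hu hau
    have hz : φ a * of π n ⟨u, hu⟩ = 0 := by
      have : φ a * of π n ⟨u, hu⟩ = _ := degOne_mul_of π (Submodule.inclusion hJI a) ⟨u, hu⟩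
      rw [this, hπ.of_eq_zero_iff]
      exact hau
    have hmem : of π n ⟨u, hu⟩ ∈ t.inf id := by
      refine Submodule.mem_finsetInf.mpr fun q hq => ?_
      have hprim : Ideal.IsPrimary q := htprim hq
      by_cases h : 𝔐 ≤ Ideal.radical q
      · exact hk q hq h (Ideal.pow_le_pow_right hn (of_mem_map_irrelevant_pow π _))
      · refine ((Ideal.isPrimary_iff.mp hprim).2 (x := of π n ⟨u, hu⟩) (y := φ a) ?_).resolve_right
          fun h' => ha (g q) (Finset.mem_image_of_mem g (Finset.mem_filter.mpr ⟨hq, h⟩)) h'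
        rw [mul_comm, hz]
        exact zero_mem q
    rw [ht] at hmem
    exact (hπ.of_eq_zero_iff ⟨u, hu⟩).mp hmem

end Blowup

/-! ### Lengths, and principal reductions in dimension one. -/

section Length

variable {R : Type*} [CommRing R]

theorem length_quotient_ne_top (K : Ideal R) [IsArtinianRing (R ⧸ K)] :
    Module.length R (R ⧸ K) ≠ ⊤ := by
  rw [Module.length_eq_of_surjective (R := R ⧸ K) Ideal.Quotient.mk_surjective]
  exact Module.length_ne_top

theorem length_quotient_eq_add {K L : Ideal R} (h : K ≤ L) :
    Module.length R (R ⧸ K) = lengthQuotient L K + Module.length R (R ⧸ L) := by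
  let f : (L ⧸ (Submodule.comap L.subtype K : Submodule R L)) →ₗ[R] R ⧸ K :=
    Submodule.mapQ _ _ L.subtype le_rfl
  let g : (R ⧸ K) →ₗ[R] R ⧸ L := Submodule.mapQ _ _ LinearMap.id h
  refine Module.length_eq_add_of_exact f g ?_ ?_ ?_
  · rw [← LinearMap.ker_eq_bot, Submodule.ker_mapQ, Submodule.mkQ_map_self]
  · exact fun y => by
      obtain ⟨x, rfl⟩ := Submodule.mkQ_surjective L y
      exact ⟨Submodule.mkQ K x, rfl⟩
  · rw [LinearMap.exact_iff, Submodule.ker_mapQ, Submodule.range_mapQ]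
    simp

theorem lengthQuotient_mono_right {K K' : Ideal R} (L : Ideal R) (h : K ≤ K') :
    lengthQuotient L K' ≤ lengthQuotient L K := by
  let f : (L ⧸ (Submodule.comap L.subtype K : Submodule R L)) →ₗ[R]
      (L ⧸ (Submodule.comap L.subtype K' : Submodule R L)) :=
    Submodule.mapQ _ _ LinearMap.id (Submodule.comap_mono h)
  refine Module.length_le_of_surjective f ?_
  intro y
  obtain ⟨x, rfl⟩ := Submodule.mkQ_surjective _ y
  exact ⟨Submodule.mkQ _ x, rfl⟩

theorem lengthQuotient_span_singleton_mul {r : R} (hr : ∀ u, r * u = 0 → u = 0) (L : Ideal R) :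
    lengthQuotient (Ideal.span {r}) (Ideal.span {r} * L) = Module.length R (R ⧸ L) := by
  let f : R →ₗ[R] Ideal.span {r} :=
    (LinearMap.toSpanSingleton R R r).codRestrict (Ideal.span {r})
      (fun c => Ideal.mul_mem_left _ _ (Ideal.mem_span_singleton_self r))
  have hf : ∀ c, (f c : R) = c * r := fun c => rfl
  have hker : L ≤ (Submodule.comap (Ideal.span {r}).subtype (Ideal.span {r} * L)).comap f := by
    intro c hc
    change (f c : R) ∈ Ideal.span {r} * L
    rw [hf, mul_comm c]
    exact Ideal.mul_mem_mul (Ideal.mem_span_singleton_self r) hc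
  symm
  refine LinearEquiv.length_eq (LinearEquiv.ofBijective (Submodule.mapQ _ _ f hker) ⟨?_, ?_⟩)
  · rw [← LinearMap.ker_eq_bot, Submodule.ker_mapQ, Submodule.eq_bot_iff]
    rintro _ ⟨c, hc, rfl⟩
    rw [Submodule.mkQ_apply, Submodule.Quotient.mk_eq_zero]
    have hc' : (f c : R) ∈ Ideal.span {r} * L := hc
    rw [hf] at hc'
    obtain ⟨y, hy, hyc⟩ := Ideal.mem_span_singleton_mul.mp hc'
    have : c - y = 0 := hr _ (by rw [mul_sub, hyc]; ring)
    rwa [sub_eq_zero.mp this]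
  · intro y
    obtain ⟨⟨x, hx⟩, rfl⟩ := Submodule.mkQ_surjective _ y
    obtain ⟨c, rfl⟩ := Ideal.mem_span_singleton'.mp hx
    exact ⟨Submodule.mkQ _ c, rfl⟩

/-- Compute `λ(R/rL)` through `L` and through `(r)`, use `(r)/rL ≅ R/L`, and cancel the finite
length `λ(R/L)`. -/
theorem lengthQuotient_smul_self {r : R} (hr : ∀ u, r * u = 0 → u = 0) (L : Ideal R)
    (hL : Module.length R (R ⧸ L) ≠ ⊤) :
    lengthQuotient L (Ideal.span {r} * L) = Module.length R (R ⧸ Ideal.span {r}) := by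
  have h1 := length_quotient_eq_add (Ideal.mul_le_left (I := Ideal.span {r}) (J := L))
  have h2 := length_quotient_eq_add (Ideal.mul_le_right (I := Ideal.span {r}) (J := L))
  rw [lengthQuotient_span_singleton_mul hr, add_comm] at h1
  exact (ENat.add_left_injective_of_ne_top hL) (h2.symm.trans h1)

/-- The number of generators of an ideal of finite colength is bounded by the colength of a regular
element. -/
theorem lengthQuotient_maximalIdeal_mul_le [IsLocalRing R] {r : R} (hrm : r ∈ maximalIdeal R)
    (hr : ∀ u, r * u = 0 → u = 0) (L : Ideal R) (hL : Module.length R (R ⧸ L) ≠ ⊤) :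
    lengthQuotient L (maximalIdeal R * L) ≤ Module.length R (R ⧸ Ideal.span {r}) := by
  rw [← lengthQuotient_smul_self hr L hL]
  exact lengthQuotient_mono_right L
    (Ideal.mul_mono_left ((Ideal.span_singleton_le_iff_mem _).mpr hrm))

theorem isArtinianRing_quotient_of_le_radical [IsNoetherianRing R] [IsLocalRing R] {L : Ideal R}
    (hL : maximalIdeal R ≤ L.radical) (hne : L ≠ ⊤) : IsArtinianRing (R ⧸ L) := by
  refine quotient_artinian_of_mem_minimalPrimes_of_isLocalRing L ?_
  refine ⟨⟨inferInstance, le_maximalIdeal hne⟩, fun P hP _ => ?_⟩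
  exact hL.trans (hP.1.radical_le_iff.mpr hP.2)

end Length

theorem ENat.exists_succ_le_of_bounded {f : ℕ → ℕ∞} {c : ℕ∞} (hc : c ≠ ⊤) (k : ℕ)
    (hf : ∀ n, f n ≤ c) : ∃ n ≥ k, f (n + 1) ≤ f n := by
  by_contra! h
  have key : ∀ i : ℕ, (i : ℕ∞) ≤ f (k + i) := by
    intro i
    induction i with
    | zero => simp
    | succ i ih =>
      push_cast
      exact (add_le_add_left ih 1).trans (Order.add_one_le_of_lt (h (k + i) (by omega)))
  lift c to ℕ using hc
  have h1 := (key (c + 1)).trans (hf _)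
  have : c + 1 ≤ c := by exact_mod_cast h1
  omega

theorem LinearMap.surjective_of_injective_of_length_le {R M N : Type*} [Ring R]
    [AddCommGroup M] [Module R M] [AddCommGroup N] [Module R N] (f : M →ₗ[R] N)
    (hf : Function.Injective f) (hN : Module.length R N ≠ ⊤)
    (h : Module.length R N ≤ Module.length R M) : Function.Surjective f := by
  have h1 := Module.length_eq_add_of_exact f f.range.mkQ hf (Submodule.mkQ_surjective _)
    (LinearMap.exact_map_mkQ_range f)
  have hM : Module.length R M ≠ ⊤ := fun h' => hN (top_le_iff.mp
    (h' ▸ Module.length_le_of_injective f hf))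
  have h2 : Module.length R (N ⧸ f.range) = 0 := by
    rw [h1] at h
    exact ENat.add_right_injective_of_ne_top hM ((h.antisymm le_self_add).trans (add_zero _).symm)
  rw [Module.length_eq_zero_iff, Submodule.Quotient.subsingleton_iff] at h2
  exact LinearMap.range_eq_top.mp h2

/-- In a one-dimensional Cohen–Macaulay local ring with infinite residue field, every reduction of
an `𝔪`-primary ideal contains a principal reduction. -/
theorem exists_pow_succ_le_span_singleton_mul {R : Type*} [CommRing R] [IsNoetherianRing R]
    [IsLocalRing R] [Infinite (ResidueField R)] {I J : Ideal R} (hIm : I ≤ maximalIdeal R)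
    (hI : maximalIdeal R ≤ I.radical) (hJI : J ≤ I) {n₀ : ℕ} (hred : I ^ (n₀ + 1) = J * I ^ n₀)
    {r : R} (hrm : r ∈ maximalIdeal R) (hr : ∀ u, r * u = 0 → u = 0)
    [IsArtinianRing (R ⧸ Ideal.span {r})] :
    ∃ a ∈ J, ∃ n, I ^ (n + 1) ≤ Ideal.span {a} * I ^ n := by
  have : IsNoetherianRing (FiberCone I) := inferInstance
  obtain ⟨s, hs, k, hk⟩ := (Blowup.isBlowup_blowupMk (maximalIdeal R) I).exists_finset_forall_mem
    hIm hI hJI hred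
  obtain ⟨a, ha⟩ := exists_forall_notMem_submodule s hs
  have hfin : ∀ n, Module.length R (R ⧸ I ^ n) ≠ ⊤ := by
    intro n
    rcases eq_or_ne (I ^ n) ⊤ with h | h
    · have : Subsingleton (R ⧸ I ^ n) := Ideal.Quotient.subsingleton_iff.mpr h
      rw [Module.length_eq_zero]
      simp
    · have hn : n ≠ 0 := by rintro rfl; simp at h
      have := isArtinianRing_quotient_of_le_radical (L := I ^ n)
        (by rwa [Ideal.radical_pow I hn]) h
      exact length_quotient_ne_top _
  -- The lengths of `Iⁿ/𝔪Iⁿ` are bounded by `λ(R/(r))`, so at some large `n` they do not increase.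
  -- There multiplication by `a`, being injective from degree `n` to `n + 1`, is also surjective,
  -- and Nakayama concludes.
  have hbound := fun n => lengthQuotient_maximalIdeal_mul_le hrm hr (I ^ n) (hfin n)
  have hc := length_quotient_ne_top (Ideal.span {r})
  obtain ⟨n, hn, hle⟩ := ENat.exists_succ_le_of_bounded hc k hbound
  refine ⟨a, a.2, n, ?_⟩
  let g : ↥(I ^ n) →ₗ[R] ↥(I ^ (n + 1)) :=
    (LinearMap.lsmul R R (a : R)).restrict fun u hu => by
      rw [pow_succ']
      exact Ideal.mul_mem_mul (hJI a.2) hu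
  have hg : ∀ u, (g u : R) = a * u := fun u => rfl
  have hker : (Submodule.comap (I ^ n).subtype (maximalIdeal R * I ^ n)) =
      (Submodule.comap (I ^ (n + 1)).subtype (maximalIdeal R * I ^ (n + 1))).comap g := by
    ext u
    simp only [Submodule.mem_comap, Submodule.subtype_apply, hg]
    refine ⟨fun hu => ?_, hk a ha n hn u u.2⟩
    have := Ideal.mul_mem_mul (hJI a.2) hu
    rwa [mul_left_comm, ← pow_succ'] at this
  have hsurj := LinearMap.surjective_of_injective_of_length_le
    (Submodule.mapQ _ _ g hker.le) (by
      rw [← LinearMap.ker_eq_bot, Submodule.ker_mapQ, ← hker, Submodule.mkQ_map_self])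
    (ne_top_of_le_ne_top hc (hbound (n + 1))) hle
  refine Submodule.le_of_le_smul_of_le_jacobson_bot (IsNoetherian.noetherian _)
    (maximalIdeal_le_jacobson ⊥) fun w hw => ?_
  obtain ⟨x, hx⟩ := hsurj (Submodule.mkQ _ ⟨w, hw⟩)
  obtain ⟨u, rfl⟩ := Submodule.mkQ_surjective _ x
  have hmem : w - a * u ∈ maximalIdeal R * I ^ (n + 1) := by
    have h1 := (Submodule.Quotient.eq _).mp hx.symm
    exact h1
  rw [← sub_add_cancel w (a * u)]
  exact add_mem (Submodule.mem_sup_right hmem) (Submodule.mem_sup_left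
    (Ideal.mul_mem_mul (Ideal.mem_span_singleton_self _) u.2))

theorem Ideal.exists_isWeaklyRegular_of_le_regularGrade {A : Type*} [CommRing A] {𝔐 : Ideal A}
    {n : ℕ} (h : (n : ℕ∞) ≤ 𝔐.regularGrade) :
    ∃ rs : List A, rs.length = n ∧ (∀ r ∈ rs, r ∈ 𝔐) ∧
      RingTheory.Sequence.IsWeaklyRegular A rs := by
  obtain ⟨rs, hrs, hreg, hn⟩ : ∃ rs : List A, (∀ r ∈ rs, r ∈ 𝔐) ∧
      RingTheory.Sequence.IsWeaklyRegular A rs ∧ n ≤ rs.length := by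
    cases n with
    -- The empty sequence is weakly regular even over the trivial ring, where no regular sequence
    -- exists.
    | zero => exact ⟨[], by simp, .nil _ _, by simp⟩
    | succ n =>
      by_contra! hcon
      have : 𝔐.regularGrade ≤ n := by
        refine iSup_le fun rs => iSup_le fun hrs => iSup_le fun hreg => ?_
        exact_mod_cast Nat.lt_succ_iff.mp (hcon rs hrs hreg.toIsWeaklyRegular)
      have h' := h.trans this
      have : n + 1 ≤ n := by exact_mod_cast h'
      omega
  refine ⟨rs.take n, by simpa using hn, fun r hr => hrs r (List.mem_of_mem_take hr), ?_⟩
  rw [← List.take_append_drop n rs, RingTheory.Sequence.isWeaklyRegular_append_iff] at hreg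
  exact hreg.1

theorem RingTheory.Sequence.IsRegular.isArtinianRing_quotient {R : Type*} [CommRing R]
    [IsNoetherianRing R] [IsLocalRing R] {rs : List R}
    (h : RingTheory.Sequence.IsRegular R rs) (hdim : ringKrullDim R = rs.length) :
    IsArtinianRing (R ⧸ Ideal.ofList rs) := by
  have h1 := ringKrullDim_add_length_eq_ringKrullDim_of_isRegular rs h
  rw [hdim] at h1
  have : Ring.KrullDimLE 0 (R ⧸ Ideal.ofList rs) := by
    rw [Ring.krullDimLE_iff]
    generalize ringKrullDim (R ⧸ Ideal.ofList rs) = x at h1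
    induction x with
    | bot => exact bot_le
    | coe x =>
      have h2 : x + (rs.length : ℕ∞) = rs.length := by exact_mod_cast h1
      have h3 : x = 0 := ENat.add_left_injective_of_ne_top (ENat.natCast_ne_top rs.length)
        (h2.trans (zero_add _).symm)
      simp [h3]
  exact IsNoetherianRing.isArtinianRing_of_krullDimLE_zero

/-! ### Minimal reductions and their generators. -/

namespace IsMinimalReduction

variable {R : Type*} [CommRing R] {I J : Ideal R}

theorem eq_of_pow_succ_le (hJ : IsMinimalReduction J I) {K : Ideal R} (hKJ : K ≤ J) {n : ℕ}
    (h : I ^ (n + 1) ≤ K * I ^ n) : K = J := by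
  refine le_antisymm hKJ (hJ.le_of_le ⟨hKJ.trans hJ.1.1, n, le_antisymm h ?_⟩ hKJ)
  rw [pow_succ']
  exact Ideal.mul_mono_left (hKJ.trans hJ.1.1)

/-- If `c ∈ J ∩ 𝔪I` were outside `𝔪J`, choose `K` maximal between `𝔪J` and `J` with `c ∉ K`. Then `J
= K + (c)`, so `Iⁿ⁺¹ ⊆ K Iⁿ + 𝔪 Iⁿ⁺¹`, and Nakayama makes `K` a strictly smaller reduction. -/
theorem inf_maximalIdeal_mul_le [IsLocalRing R] [IsNoetherianRing R]
    (hJ : IsMinimalReduction J I) : J ⊓ maximalIdeal R * I ≤ maximalIdeal R * J := by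
  rintro c ⟨hcJ, hcI⟩
  by_contra hc
  obtain ⟨K, ⟨hK1, hK2, hK3⟩, hmax⟩ := (wellFounded_gt (α := Ideal R)).has_min
    {K | maximalIdeal R * J ≤ K ∧ K ≤ J ∧ c ∉ K} ⟨_, le_rfl, Ideal.mul_le_right, hc⟩
  have hle : J ≤ K ⊔ Ideal.span {c} := by
    intro y hy
    by_cases hyK : y ∈ K
    · exact Ideal.mem_sup_left hyK
    have hc' : c ∈ K ⊔ Ideal.span {y} := by
      by_contra hcK
      refine hmax (K ⊔ Ideal.span {y}) ⟨hK1.trans le_sup_left,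
        sup_le hK2 ((Ideal.span_singleton_le_iff_mem _).mpr hy), hcK⟩ ?_
      exact lt_of_le_of_ne le_sup_left fun h =>
        hyK (h ▸ Ideal.mem_sup_right (Ideal.mem_span_singleton_self y))
    obtain ⟨x, hx, z, hz, hxz⟩ := Submodule.mem_sup.mp hc'
    obtain ⟨s, rfl⟩ := Ideal.mem_span_singleton'.mp hz
    -- From `c = x + s y`: if `s ∈ 𝔪` then `s y ∈ 𝔪J ⊆ K` forces `c ∈ K`; otherwise solve for `y`.
    by_cases hs : s ∈ maximalIdeal R
    · exact absurd (hxz ▸ add_mem hx (hK1 (Ideal.mul_mem_mul hs hy))) hK3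
    · obtain ⟨s, rfl⟩ : IsUnit s := by simpa using hs
      have : y = (-((s⁻¹ : Rˣ) : R) * x) + ((s⁻¹ : Rˣ) : R) * c := by
        rw [← hxz, mul_add, ← mul_assoc]
        simp
      rw [this]
      exact add_mem (Ideal.mem_sup_left (K.mul_mem_left _ hx))
        (Ideal.mem_sup_right (Ideal.mul_mem_left _ _ (Ideal.mem_span_singleton_self c)))
  obtain ⟨n, hn⟩ := hJ.1.2
  refine hK3 ((hJ.eq_of_pow_succ_le hK2 (n := n) ?_) ▸ hcJ)
  refine Submodule.le_of_le_smul_of_le_jacobson_bot (IsNoetherian.noetherian _)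
    (maximalIdeal_le_jacobson ⊥) ?_
  calc I ^ (n + 1) = J * I ^ n := hn
    _ ≤ (K ⊔ Ideal.span {c}) * I ^ n := Ideal.mul_mono_left hle
    _ = K * I ^ n ⊔ Ideal.span {c} * I ^ n := Ideal.sup_mul _ _ _
    _ ≤ K * I ^ n ⊔ maximalIdeal R * I ^ (n + 1) := by
      refine sup_le_sup_left ?_ _
      rw [pow_succ', ← mul_assoc]
      exact Ideal.mul_mono_left ((Ideal.span_singleton_le_iff_mem _).mpr hcI)

end IsMinimalReduction

namespace Blowup

variable {R : Type*} [CommRing R] [IsLocalRing R] {I J : Ideal R}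

theorem maximalIdeal_le_of_pow_succ_eq (hI : maximalIdeal R ≤ I.radical) {n₀ : ℕ}
    (hred : I ^ (n₀ + 1) = J * I ^ n₀) {P : Ideal R} (hP : P.IsPrime) (hJP : J ≤ P) :
    maximalIdeal R ≤ P := by
  refine hI.trans (hP.radical_le_iff.mpr ?_)
  refine hP.le_of_pow_le (n := n₀ + 1) ?_
  rw [hred]
  exact Ideal.mul_le_left.trans hJP

/-- The principal reduction theorem applied in `R/Q` and lifted back; in the application `Q` is
generated by a regular sequence one shorter than `dim R`. -/
theorem exists_pow_succ_le_span_sup [IsNoetherianRing R] [Infinite (ResidueField R)]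
    (hIm : I ≤ maximalIdeal R) (hI : maximalIdeal R ≤ I.radical) (hJI : J ≤ I) {n₀ : ℕ}
    (hred : I ^ (n₀ + 1) = J * I ^ n₀) {Q : Ideal R} (hQ : Q ≤ maximalIdeal R) {r : R}
    (hrm : r ∈ maximalIdeal R) (hr : ∀ u, r * u ∈ Q → u ∈ Q)
    [IsArtinianRing (R ⧸ (Q ⊔ Ideal.span {r}))] :
    ∃ a ∈ J, ∃ n, I ^ (n + 1) ≤ Ideal.span {a} * I ^ n ⊔ Q := by
  let q := Ideal.Quotient.mk Q
  have hq : Function.Surjective q := Ideal.Quotient.mk_surjective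
  have : Nontrivial (R ⧸ Q) :=
    Ideal.Quotient.nontrivial_iff.mpr (ne_top_of_le_ne_top (Ideal.IsPrime.ne_top inferInstance) hQ)
  have : IsLocalRing (R ⧸ Q) := .of_surjective' q hq
  have hloc : IsLocalHom q := IsLocalHom.of_surjective q hq
  have : Infinite (ResidueField (R ⧸ Q)) :=
    Infinite.of_injective (ResidueField.map q) (ResidueField.map q).injective
  have hmem : ∀ x, q x ∈ maximalIdeal (R ⧸ Q) ↔ x ∈ maximalIdeal R := by
    intro x
    simp only [mem_maximalIdeal, mem_nonunits_iff, isUnit_map_iff]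
  have : IsArtinianRing ((R ⧸ Q) ⧸ Ideal.span {q r}) := by
    let f : R →+* (R ⧸ Q) ⧸ Ideal.span {q r} := (Ideal.Quotient.mk _).comp q
    have hf : Function.Surjective f := Ideal.Quotient.mk_surjective.comp hq
    let g : R ⧸ (Q ⊔ Ideal.span {r}) →+* (R ⧸ Q) ⧸ Ideal.span {q r} :=
      Ideal.Quotient.lift _ f (by
        have : Q ⊔ Ideal.span {r} ≤ RingHom.ker f := by
          refine sup_le (fun x hx => ?_) ((Ideal.span_singleton_le_iff_mem _).mpr ?_)
          · have : q x = 0 := Ideal.Quotient.eq_zero_iff_mem.mpr hx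
            simp [f, this]
          · exact Ideal.Quotient.eq_zero_iff_mem.mpr (Ideal.mem_span_singleton_self _)
        exact fun x hx => this hx)
    exact (Ideal.Quotient.lift_surjective_of_surjective _ _ hf : Function.Surjective g).isArtinianRing
  obtain ⟨a', ha', n, hn⟩ := exists_pow_succ_le_span_singleton_mul (R := R ⧸ Q)
    (I := I.map q) (J := J.map q) (n₀ := n₀) (r := q r)
    (Ideal.map_le_iff_le_comap.mpr fun x hx => (hmem x).mpr (hIm hx))
    (fun x hx => by
      obtain ⟨x, rfl⟩ := hq x
      obtain ⟨k, hk⟩ := hI ((hmem x).mp hx)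
      exact ⟨k, by rw [← map_pow]; exact Ideal.mem_map_of_mem q hk⟩)
    (Ideal.map_mono hJI) (by rw [← Ideal.map_pow, hred, Ideal.map_mul, Ideal.map_pow])
    ((hmem r).mpr hrm)
    (fun u hu => by
      obtain ⟨u, rfl⟩ := hq u
      rw [← map_mul] at hu
      exact Ideal.Quotient.eq_zero_iff_mem.mpr (hr u (Ideal.Quotient.eq_zero_iff_mem.mp hu)))
  obtain ⟨a, ha, rfl⟩ := (Ideal.mem_map_iff_of_surjective q hq).mp ha'
  refine ⟨a, ha, n, ?_⟩
  rw [← Ideal.map_pow, ← Ideal.map_pow, ← Set.image_singleton, ← Ideal.map_span, ← Ideal.map_mul,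
    Ideal.map_le_iff_le_comap, Ideal.comap_map_of_surjective q hq] at hn
  refine hn.trans (sup_le_sup_left (le_of_eq ?_) _)
  rw [← RingHom.ker_eq_comap_bot]
  exact Ideal.mk_ker

/-- If `depth G(I) ≥ d - 1`, a minimal reduction of `I` is generated by a regular sequence of length
`d` whose first `d - 1` elements satisfy the Valabrega–Valla conditions. -/
theorem exists_generators_of_isBlowup [IsNoetherianRing R] [Infinite (ResidueField R)]
    {A : Type*} [CommRing A] [Algebra R A] [IsNoetherianRing A] {π : reesAlgebra I →ₐ[R] A}
    (hπ : IsBlowup I π) (hIm : I ≤ maximalIdeal R) (hI : maximalIdeal R ≤ I.radical)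
    (hJ : IsMinimalReduction J I) {d : ℕ} (hdim : ringKrullDim R = (d + 1 : ℕ))
    {rs : List R} (hrsl : rs.length = d + 1) (hrs : ∀ r ∈ rs, r ∈ maximalIdeal R)
    (hrsreg : RingTheory.Sequence.IsWeaklyRegular R rs)
    {ts : List A} (htsl : ts.length = d) (hts : ∀ t ∈ ts, t ∈ (reesIrrelevantIdeal I).map π)
    (htsreg : RingTheory.Sequence.IsWeaklyRegular A ts) :
    ∃ as : List ↥I, Ideal.ofList (as.map Subtype.val) = J ∧
      (∀ i (h : i < as.length) (u : R), as[i] * u ∈ Ideal.ofList ((as.take i).map Subtype.val) →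
        u ∈ Ideal.ofList ((as.take i).map Subtype.val)) ∧
      ∀ i < as.length, ∀ n, Ideal.ofList ((as.take i).map Subtype.val) ⊓ I ^ (n + 1) ≤
        Ideal.ofList ((as.take i).map Subtype.val) * I ^ n := by
  have hJI := hJ.1.1
  obtain ⟨n₀, hred⟩ := hJ.1.2
  -- The same `d` elements of `J` are made regular on `R` and, through their forms, on `A`. Here
  -- `dim R = d + 1`, so one original element `r` survives on the side of `R`.
  obtain ⟨bs₀, hbsl, h1, h2⟩ := RingTheory.Sequence.exists_isWeaklyRegular_map_append
    (J.subtype : J →ₗ[R] R) (degOne π ∘ₗ Submodule.inclusion hJI)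
    (𝔐 := maximalIdeal R) (𝔑 := (reesIrrelevantIdeal I).map π)
    (fun P hP h => maximalIdeal_le_of_pow_succ_eq hI hred hP fun a ha => h ⟨a, ha⟩)
    (fun P hP h => hπ.map_irrelevant_le le_rfl hI hJI hred hP h) d R A rs ts hrs hts
    (by omega) (by omega) hrsreg htsreg
  obtain ⟨bs, hbs⟩ : ∃ bs, bs = bs₀.map (Submodule.inclusion hJI) := ⟨_, rfl⟩
  have hbsJ : ∀ b ∈ bs, (b : R) ∈ J := by
    intro b hb
    rw [hbs] at hb
    obtain ⟨b, -, rfl⟩ := List.mem_map.mp hb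
    exact b.2
  have hlen : bs.length = d := by rw [hbs, List.length_map, hbsl]
  have e1 : bs₀.map J.subtype = bs.map Subtype.val := by
    rw [hbs, List.map_map]
    rfl
  have e2 : bs₀.map (degOne π ∘ₗ Submodule.inclusion hJI) = bs.map (degOne π) := by
    rw [hbs, List.map_map]
    rfl
  obtain ⟨r, hr⟩ : ∃ r, rs.take (rs.length - d) = [r] := by
    refine List.length_eq_one_iff.mp ?_
    rw [List.length_take]
    omega
  have hrm : r ∈ maximalIdeal R := hrs r (List.mem_of_mem_take (hr ▸ List.mem_singleton_self r))
  rw [e1, hr] at h1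
  rw [e2, htsl, Nat.sub_self, List.take_zero, List.append_nil, hπ.isWeaklyRegular_iff] at h2
  have hVV := h2.ofList_inf_pow_le
  have hregR : RingTheory.Sequence.IsRegular R (bs.map Subtype.val ++ [r]) := by
    refine .of_isWeaklyRegular_of_mem_maximalIdeal R ?_ h1
    intro x hx
    rcases List.mem_append.mp hx with hx | hx
    · obtain ⟨b, -, rfl⟩ := List.mem_map.mp hx
      exact hIm b.2
    · rwa [List.mem_singleton.mp hx]
  set Q := Ideal.ofList (bs.map Subtype.val) with hQ
  have hQI : Q ≤ I := ofList_map_val_le bs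
  have hart : IsArtinianRing (R ⧸ (Q ⊔ Ideal.span {r})) := by
    have := hregR.isArtinianRing_quotient (by simp [hdim, hlen])
    rwa [Ideal.ofList_append, Ideal.ofList_singleton] at this
  rw [RingTheory.Sequence.isWeaklyRegular_append_iff,
    RingTheory.Sequence.isWeaklyRegular_singleton_iff,
    isSMulRegular_quotient_iff_mem_of_smul_mem] at h1
  obtain ⟨h1, h3⟩ := h1
  have hrQ : ∀ u, r * u ∈ Q → u ∈ Q := by
    intro u hu
    have hQtop : (Ideal.ofList (bs.map Subtype.val) • ⊤ : Submodule R R) = Q := Ideal.mul_top Q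
    have h4 := h3 u
    rw [hQtop] at h4
    exact h4 hu
  obtain ⟨a, ha, n, hn⟩ := exists_pow_succ_le_span_sup hIm hI hJI hred (hQI.trans hIm) hrm hrQ
  have hQJ : Q ≤ J := by
    refine Ideal.span_le.mpr fun x hx => ?_
    obtain ⟨b, hb, rfl⟩ := List.mem_map.mp hx
    exact hbsJ b hb
  have haI : Ideal.span {a} ≤ I := (Ideal.span_singleton_le_iff_mem _).mpr (hJI ha)
  -- For `w ∈ Iⁿ⁺¹`, the part of `w` in `Q` lies in `Q ∩ Iⁿ⁺¹ ⊆ Q Iⁿ`. So `Q + (a)` is a reduction,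
  -- and equals `J` by minimality.
  have hKJ : Q ⊔ Ideal.span {a} = J := by
    refine hJ.eq_of_pow_succ_le
      (sup_le hQJ ((Ideal.span_singleton_le_iff_mem _).mpr ha)) (n := n) fun w hw => ?_
    obtain ⟨x, hx, y, hy, rfl⟩ := Submodule.mem_sup.mp (hn hw)
    have hxI : x ∈ I ^ (n + 1) := by
      rw [pow_succ']
      exact Ideal.mul_mono_left haI hx
    rw [Ideal.sup_mul, add_comm]
    refine add_mem (Ideal.mem_sup_left ?_) (Ideal.mem_sup_right hx)
    have := hVV bs.length le_rfl n
    rw [List.take_length] at this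
    exact this ⟨hy, by simpa using sub_mem hw hxI⟩
  have htake : ∀ i ≤ bs.length, (bs ++ [(⟨a, hJI ha⟩ : ↥I)]).take i = bs.take i := fun i hi =>
    List.take_append_of_le_length hi
  refine ⟨bs ++ [⟨a, hJI ha⟩], ?_, ?_, ?_⟩
  · rw [List.map_append, Ideal.ofList_append, ← hKJ]
    simp [hQ]
  · intro i hi u
    have hi' : i ≤ bs.length := by simpa [Nat.lt_succ_iff] using hi
    rw [htake i hi']
    rcases hi'.lt_or_eq with hi' | rfl
    · rw [List.getElem_append_left hi']
      exact (isWeaklyRegular_map_iff Subtype.val bs).mp h1 i hi' u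
    · simp only [List.getElem_concat_length, List.take_length]
      rw [← hQ]
      intro hau
      -- Regularity of `a` modulo `Q`: from `a u ∈ Q` it follows that `J u ⊆ Q`; a power of `r` lies
      -- in `J`, and `r` is regular modulo `Q`.
      have hJu : ∀ x ∈ J, x * u ∈ Q := by
        intro x hx
        rw [← hKJ] at hx
        obtain ⟨y, hy, z, hz, rfl⟩ := Submodule.mem_sup.mp hx
        obtain ⟨c, rfl⟩ := Ideal.mem_span_singleton'.mp hz
        rw [add_mul, mul_assoc]
        exact add_mem (Q.mul_mem_right _ hy) (Q.mul_mem_left _ hau)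
      have hpow : ∀ N, r ^ N * u ∈ Q → u ∈ Q := by
        intro N
        induction N with
        | zero => simp
        | succ N ih =>
          intro h
          rw [pow_succ', mul_assoc] at h
          exact ih (hrQ _ h)
      obtain ⟨k, hk⟩ := hI hrm
      have hrJ : (r ^ k) ^ (n₀ + 1) ∈ J :=
        Ideal.mul_le_left (hred ▸ Ideal.pow_mem_pow hk (n₀ + 1))
      rw [← pow_mul] at hrJ
      exact hpow _ (hJu _ hrJ)
  · intro i hi n
    have hi' : i ≤ bs.length := by simpa [Nat.lt_succ_iff] using hi
    rw [htake i hi']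
    exact hVV i hi' n

end Blowup

/-! ### From a Cohen–Macaulay fiber cone to regular forms. -/

namespace Blowup

variable {R : Type*} [CommRing R] [IsLocalRing R] {I J : Ideal R}
  {A : Type*} [CommRing A] [Algebra R A] {π : reesAlgebra I →ₐ[R] A}

theorem isMaximal_reesIrrelevantIdeal (I : Ideal R) : (reesIrrelevantIdeal I).IsMaximal := by
  refine Ideal.comap_isMaximal_of_surjective _ (fun r => ?_)
  exact ⟨algebraMap R (reesAlgebra I) r, by simp⟩

theorem IsBlowup.isMaximal_map_irrelevant (hπ : IsBlowup (maximalIdeal R) π) :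
    ((reesIrrelevantIdeal I).map π).IsMaximal := by
  have := isMaximal_reesIrrelevantIdeal I
  refine Ideal.IsMaximal.map_of_surjective_of_ker_le (f := (π : reesAlgebra I →+* A))
    hπ.surjective fun f hf => ?_
  have := (hπ.eq_zero_iff f).mp hf 0
  rw [mem_reesIrrelevantIdeal]
  simpa using this

theorem slice_mem_of_mul_mem {𝔞 Q : Ideal R} {n : ℕ} {c u : R} (hc : c ∉ maximalIdeal R)
    (h : c * u ∈ slice 𝔞 I Q n) : u ∈ slice 𝔞 I Q n := by
  obtain ⟨c, rfl⟩ : IsUnit c := by simpa using hc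
  have := (slice 𝔞 I Q n).mul_mem_left ((c⁻¹ : Rˣ) : R) h
  rwa [← mul_assoc, Units.inv_mul, one_mul] at this

/-- Homogeneous elements can be contracted from the localization at the homogeneous maximal
ideal. -/
theorem IsBlowup.mem_slice_of_algebraMap_mem {𝔞 : Ideal R} (hπ : IsBlowup 𝔞 π) {𝔫 : Ideal A}
    [𝔫.IsPrime] (h𝔫 : 𝔫 = (reesIrrelevantIdeal I).map π) (as : List ↥I) {n : ℕ} (u : ↥(I ^ n))
    (h : algebraMap A (Localization.AtPrime 𝔫) (of π n u) ∈
      Ideal.ofList ((as.map (degOne π)).map (algebraMap A (Localization.AtPrime 𝔫)))) :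
    (u : R) ∈ slice 𝔞 I (Ideal.ofList (as.map Subtype.val)) n := by
  rw [← Ideal.map_ofList, IsLocalization.algebraMap_mem_map_algebraMap_iff 𝔫.primeCompl] at h
  obtain ⟨s, hs, hsu⟩ := h
  obtain ⟨f, rfl⟩ := hπ.surjective s
  -- A denominator has unit constant coefficient, so the degree `n` coefficient of the product
  -- recovers `u` up to a unit.
  have hf : (f : Polynomial R).coeff 0 ∉ maximalIdeal R := fun h =>
    hs (h𝔫 ▸ Ideal.mem_map_of_mem π (mem_reesIrrelevantIdeal.mpr h))
  rw [of_apply, ← map_mul, hπ.map_mem_ofList_iff] at hsu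
  have := hsu n
  rw [Subalgebra.coe_mul, coe_reesMonomial, ← Polynomial.C_mul_X_pow_eq_monomial, mul_left_comm,
    Polynomial.coeff_C_mul, Polynomial.coeff_mul_X_pow', if_pos le_rfl, Nat.sub_self,
    mul_comm] at this
  exact slice_mem_of_mul_mem hf this

/-- In the localization `B` at the homogeneous maximal ideal, a regular sequence of length `dim B`
can be replaced by forms of generic elements of `J`. Modulo these `B` is Artinian; contracting to
homogeneous elements of large degree shows, with Nakayama, that they generate a reduction, hence all
of `J`. Regularity contracts in the same way. -/
theorem exists_formRegular_of_isCohenMacaulay [IsNoetherianRing R] [Infinite (ResidueField R)]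
    [IsNoetherianRing A] (hπ : IsBlowup (maximalIdeal R) π) (hIm : I ≤ maximalIdeal R)
    (hI : maximalIdeal R ≤ I.radical) (hJ : IsMinimalReduction J I) (hA : IsCohenMacaulayRing A) :
    ∃ as : List ↥I, Ideal.ofList (as.map Subtype.val) = J ∧ FormRegular (maximalIdeal R) as := by
  have hJI := hJ.1.1
  obtain ⟨n₀, hred⟩ := hJ.1.2
  obtain ⟨𝔫, h𝔫⟩ : ∃ 𝔫, 𝔫 = (reesIrrelevantIdeal I).map π := ⟨_, rfl⟩
  have hmax : 𝔫.IsMaximal := h𝔫 ▸ hπ.isMaximal_map_irrelevant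
  let B := Localization.AtPrime 𝔫
  have hB : IsCohenMacaulayLocalRing B := hA.2 𝔫
  have : IsNoetherianRing B := hB.1
  obtain ⟨e, he⟩ : ∃ e : ℕ, ringKrullDim B = e := by
    have h1 : ringKrullDim B ≠ ⊤ := ringKrullDim_ne_top
    have h2 : ringKrullDim B ≠ ⊥ := ringKrullDim_ne_bot
    rw [← hB.2] at h1 ⊢
    generalize (maximalIdeal B).regularGrade = x at h1
    induction x with
    | top => exact absurd rfl h1
    | coe n => exact ⟨n, rfl⟩
  have hgrade : (e : ℕ∞) ≤ (maximalIdeal B).regularGrade := by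
    have := hB.2.trans he
    have h' : (maximalIdeal B).regularGrade = e := by exact_mod_cast this
    exact h'.ge
  obtain ⟨rs, hrsl, hrs, hrsreg⟩ := Ideal.exists_isWeaklyRegular_of_le_regularGrade hgrade
  let ψ : J →ₗ[R] B :=
    (IsScalarTower.toAlgHom R A B).toLinearMap ∘ₗ degOne π ∘ₗ Submodule.inclusion hJI
  have hψ : ∀ a, ψ a = algebraMap A B (degOne π (Submodule.inclusion hJI a)) := fun a => rfl
  have hprime : ∀ P : Ideal B, P.IsPrime → (∀ a, ψ a ∈ P) → maximalIdeal B ≤ P := by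
    intro P hP h
    rw [← Localization.AtPrime.map_eq_maximalIdeal, Ideal.map_le_iff_le_comap]
    refine h𝔫.trans_le ?_
    exact hπ.map_irrelevant_le hIm hI hJI hred (hP.comap _) fun a => h a
  -- Only one module is needed, so the simultaneous statement is used with both copies equal to `B`.
  obtain ⟨bs₀, hbsl, h1, -⟩ := RingTheory.Sequence.exists_isWeaklyRegular_map_append
    ψ ψ hprime hprime e B B rs rs hrs hrs (by omega) (by omega) hrsreg hrsreg
  rw [hrsl, Nat.sub_self, List.take_zero, List.append_nil] at h1
  obtain ⟨bs, hbs⟩ : ∃ bs, bs = bs₀.map (Submodule.inclusion hJI) := ⟨_, rfl⟩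
  have e1 : bs₀.map ψ = (bs.map (degOne π)).map (algebraMap A B) := by
    rw [hbs, List.map_map, List.map_map]
    rfl
  have hlen : bs.length = e := by rw [hbs, List.length_map, hbsl]
  have hreg : RingTheory.Sequence.IsRegular B (bs₀.map ψ) := by
    refine .of_isWeaklyRegular_of_mem_maximalIdeal B ?_ h1
    intro x hx
    obtain ⟨b, -, rfl⟩ := List.mem_map.mp hx
    rw [hψ, IsLocalization.AtPrime.to_map_mem_maximal_iff B 𝔫, h𝔫]
    exact degOne_mem_map_irrelevant π _
  have hart := hreg.isArtinianRing_quotient (by simp [he, hbsl])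
  obtain ⟨N, hN⟩ := exists_maximalIdeal_pow_le_of_isArtinianRing_quotient (Ideal.ofList (bs₀.map ψ))
  rw [e1] at hN h1
  refine ⟨bs, ?_, ?_⟩
  · refine hJ.eq_of_pow_succ_le ?_ (n := N) ?_
    · refine Ideal.span_le.mpr fun x hx => ?_
      rw [hbs] at hx
      obtain ⟨b, hb, rfl⟩ := List.mem_map.mp hx
      obtain ⟨b, -, rfl⟩ := List.mem_map.mp hb
      exact b.2
    · refine Submodule.le_of_le_smul_of_le_jacobson_bot (IsNoetherian.noetherian _)
        (maximalIdeal_le_jacobson ⊥) fun w hw => ?_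
      have hw' := hπ.mem_slice_of_algebraMap_mem h𝔫 bs ⟨w, hw⟩ (by
        refine hN (Ideal.pow_le_pow_right (Nat.le_succ N) ?_)
        rw [← Localization.AtPrime.map_eq_maximalIdeal, ← Ideal.map_pow]
        refine Ideal.mem_map_of_mem _ ?_
        rw [h𝔫]
        exact of_mem_map_irrelevant_pow π _)
      rwa [slice, sup_comm] at hw'
  · intro i hi n u hu hau
    have h2 := (isWeaklyRegular_map_iff (fun b => algebraMap A B (degOne π b)) bs).mp
      (by rwa [List.map_map] at h1) i hi (algebraMap A B (of π n ⟨u, hu⟩))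
    have e2 : (bs.take i).map (fun b => algebraMap A B (degOne π b)) =
        ((bs.take i).map (degOne π)).map (algebraMap A B) := by
      rw [List.map_map]
      rfl
    rw [e2] at h2
    refine hπ.mem_slice_of_algebraMap_mem h𝔫 (bs.take i) ⟨u, hu⟩ (h2 ?_)
    rw [← map_mul, degOne_mul_of, ← Ideal.map_ofList]
    exact Ideal.mem_map_of_mem _ (hπ.of_mem_ofList hau)

end Blowup

/-! ### Finite flat algebras over polynomial rings are Cohen–Macaulay. -/

section MonicSequences

open RingTheory.Sequence

theorem isWeaklyRegular_self_cons_iff {A : Type*} [CommRing A] (x : A) (rs : List A) :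
    IsWeaklyRegular A (x :: rs) ↔ IsSMulRegular A x ∧
      IsWeaklyRegular (A ⧸ Ideal.span {x}) (rs.map (Ideal.Quotient.mk (Ideal.span {x}))) := by
  rw [isWeaklyRegular_cons_iff, ← Ideal.Quotient.algebraMap_eq, isWeaklyRegular_map_algebraMap_iff]
  refine and_congr_right fun _ => LinearEquiv.isWeaklyRegular_congr ?_ rs
  refine Submodule.quotEquivOfEq _ _ ?_
  rw [← Submodule.ideal_span_singleton_smul, smul_eq_mul, Ideal.mul_top]

theorem Polynomial.Monic.isWeaklyRegular_cons_map_C {C : Type*} [CommRing C]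
    {p : Polynomial C} (hp : p.Monic) {rs : List C} (h : IsWeaklyRegular C rs) :
    IsWeaklyRegular (Polynomial C) (p :: rs.map Polynomial.C) := by
  rw [isWeaklyRegular_self_cons_iff]
  refine ⟨fun a b hab => hp.isRegular.left hab, ?_⟩
  have := hp.free_quotient
  have h' := h.of_flat (S := Polynomial C ⧸ Ideal.span {p})
  rwa [List.map_map]

/-- Split off the first variable: modulo a monic polynomial in it the ring is free over the
polynomials in the others, so the remaining sequence stays regular by flatness. -/
theorem MvPolynomial.isWeaklyRegular_ofFn_aeval_X {k : Type*} [CommRing k] {d : ℕ}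
    (p : Fin d → Polynomial k) (hp : ∀ i, (p i).Monic) :
    IsWeaklyRegular (MvPolynomial (Fin d) k)
      (List.ofFn fun i => Polynomial.aeval (MvPolynomial.X i : MvPolynomial (Fin d) k) (p i)) := by
  induction d with
  | zero => simp
  | succ d ih =>
    have h := Polynomial.Monic.isWeaklyRegular_cons_map_C
      ((hp 0).map (MvPolynomial.C (σ := Fin d))) (ih (fun i => p i.succ) fun i => hp i.succ)
    refine ((finSuccEquiv k d).toAddEquiv.isWeaklyRegular_congr ?_).mpr h
    have h0 : ∀ i : Fin (d + 1), finSuccEquiv k d (Polynomial.aeval (X i) (p i)) =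
        Polynomial.aeval (finSuccEquiv k d (X i)) (p i) := fun i =>
      (Polynomial.aeval_algHom_apply (finSuccEquiv k d).toAlgHom (X i) (p i)).symm
    have hlist : (Polynomial.map (C (σ := Fin d)) (p 0) ::
        (List.ofFn fun i : Fin d => Polynomial.aeval (X i) (p i.succ)).map Polynomial.C) =
        (List.ofFn fun i => Polynomial.aeval (X i) (p i)).map (finSuccEquiv k d) := by
      rw [List.ofFn_succ, List.map_cons, h0, finSuccEquiv_X_zero, List.map_ofFn, List.map_ofFn]
      refine congrArg₂ List.cons ?_ (congrArg List.ofFn ?_)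
      · rw [Polynomial.aeval_X_left_eq_map]
        rfl
      · funext i
        rw [Function.comp_apply, Function.comp_apply, h0, finSuccEquiv_X_succ]
        exact (Polynomial.aeval_algHom_apply (Polynomial.CAlgHom (R := k)
          (A := MvPolynomial (Fin d) k)) (X i) (p i.succ)).symm
    rw [hlist]
    refine List.forall₂_map_right_iff.mpr (List.forall₂_same.mpr fun r _ x => ?_)
    exact map_mul (finSuccEquiv k d) r x

end MonicSequences

theorem ringKrullDim_le_of_isIntegral (B A : Type*) [CommRing B] [CommRing A] [Algebra B A]
    [Algebra.IsIntegral B A] : ringKrullDim A ≤ ringKrullDim B := by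
  refine Order.krullDim_le_of_strictMono (PrimeSpectrum.comap (algebraMap B A)) fun P Q h => ?_
  exact Ideal.IsIntegral.comap_lt_comap h

/-- A maximal ideal contracts to a maximal ideal of the polynomial ring, whose residue field is
finite over `k`, so it contains a monic polynomial in each variable. These `d` elements form a
regular sequence, which survives flat extension and localization. Thus depth is at least `d`, while
integrality bounds the dimension by `d`. -/
theorem isCohenMacaulayRing_of_flat_mvPolynomial (k : Type*) [Field k] {d : ℕ} {A : Type*}
    [CommRing A] [IsNoetherianRing A] [Algebra (MvPolynomial (Fin d) k) A]
    [Module.Finite (MvPolynomial (Fin d) k) A] [Module.Flat (MvPolynomial (Fin d) k) A] :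
    IsCohenMacaulayRing A := by
  refine ⟨inferInstance, fun 𝔫 h𝔫 => ⟨inferInstance, ?_⟩⟩
  let B := MvPolynomial (Fin d) k
  have hint : Algebra.IsIntegral B A := inferInstance
  have hmax : (𝔫.comap (algebraMap B A)).IsMaximal :=
    Ideal.isMaximal_comap_of_isIntegral_of_isMaximal 𝔫
  let _ := Ideal.Quotient.field (𝔫.comap (algebraMap B A))
  have hfin : Module.Finite k (B ⧸ 𝔫.comap (algebraMap B A)) :=
    finite_of_finite_type_of_isJacobsonRing _ _
  have hex : ∀ i : Fin d, ∃ p : Polynomial k, p.Monic ∧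
      Polynomial.aeval (MvPolynomial.X i : B) p ∈ 𝔫.comap (algebraMap B A) := by
    intro i
    obtain ⟨p, hp, hp0⟩ := Algebra.IsIntegral.isIntegral (R := k)
      (Ideal.Quotient.mk (𝔫.comap (algebraMap B A)) (MvPolynomial.X i : B))
    refine ⟨p, hp, Ideal.Quotient.eq_zero_iff_mem.mp ?_⟩
    exact (Polynomial.aeval_algHom_apply (Ideal.Quotient.mkₐ k (𝔫.comap (algebraMap B A)))
      (MvPolynomial.X i : B) p).symm.trans hp0
  choose p hp hpmem using hex
  have h1 := (MvPolynomial.isWeaklyRegular_ofFn_aeval_X p hp).of_flat (S := A)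
  have h2 := h1.isRegular_of_isLocalization_of_mem (Localization.AtPrime 𝔫) 𝔫 (by
    intro r hr
    obtain ⟨b, hb, rfl⟩ := List.mem_map.mp hr
    obtain ⟨i, rfl⟩ := List.mem_ofFn.mp hb
    exact hpmem i)
  have hle : ringKrullDim (Localization.AtPrime 𝔫) ≤ d := by
    rw [IsLocalization.AtPrime.ringKrullDim_eq_height 𝔫]
    refine (Ideal.height_le_ringKrullDim_of_ne_top h𝔫.ne_top).trans ?_
    refine (ringKrullDim_le_of_isIntegral B A).trans ?_
    rw [MvPolynomial.ringKrullDim_of_isNoetherianRing, ringKrullDim_eq_zero_of_field]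
    simp
  refine le_antisymm ?_ ?_
  · have : ∀ rs : List (Localization.AtPrime 𝔫),
        RingTheory.Sequence.IsRegular (Localization.AtPrime 𝔫) rs →
        (rs.length : WithBot ℕ∞) ≤ ringKrullDim (Localization.AtPrime 𝔫) := by
      intro rs hrs
      rw [← ringKrullDim_add_length_eq_ringKrullDim_of_isRegular rs hrs]
      have : Nontrivial (Localization.AtPrime 𝔫 ⧸ Ideal.ofList rs) := by
        refine Ideal.Quotient.nontrivial_iff.mpr fun h => hrs.top_ne_smul ?_
        rw [h, smul_eq_mul, Ideal.mul_top]
      exact le_add_of_nonneg_left ringKrullDim_nonneg_of_nontrivial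
    obtain ⟨e, he⟩ : ∃ e : ℕ∞, ringKrullDim (Localization.AtPrime 𝔫) = e :=
      ⟨_, (WithBot.coe_unbot _ ringKrullDim_ne_bot).symm⟩
    rw [he]
    refine WithBot.coe_le_coe.mpr (iSup_le fun rs => iSup_le fun _ => iSup_le fun hrs => ?_)
    have := (this rs hrs).trans_eq he
    exact_mod_cast this
  · refine hle.trans ?_
    have : (d : ℕ∞) ≤ (maximalIdeal (Localization.AtPrime 𝔫)).regularGrade := by
      refine le_trans ?_ (le_iSup_of_le _ (le_iSup_of_le ?_ (le_iSup_of_le h2 le_rfl)))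
      · simp
      · intro r hr
        obtain ⟨a, ha, rfl⟩ := List.mem_map.mp hr
        obtain ⟨b, hb, rfl⟩ := List.mem_map.mp ha
        obtain ⟨i, rfl⟩ := List.mem_ofFn.mp hb
        exact (IsLocalization.AtPrime.to_map_mem_maximal_iff _ 𝔫 _).mpr (hpmem i)
    exact_mod_cast this

/-! ### Freeness over the polynomial ring in regular forms. -/

section LinearIndependence

open Polynomial in
-- Reducing modulo `x` kills the constant coefficients; then cancel the regular element `x` and
-- induct on a bound for the degrees.
theorem Polynomial.eq_zero_of_sum_eval₂_mul_eq_zero {C A ι : Type*} [CommRing C] [CommRing A]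
    (τ : C →+* A) {x : A} (hx : IsSMulRegular A x) (s : Finset ι) (f : ι → A)
    (H : ∀ c : ι → C, ∑ i ∈ s, τ (c i) * f i ∈ Ideal.span {x} → ∀ i ∈ s, c i = 0)
    (P : ι → C[X]) (hP : ∑ i ∈ s, (P i).eval₂ τ x * f i = 0) : ∀ i ∈ s, P i = 0 := by
  suffices ∀ (N : ℕ) (P : ι → C[X]), (∀ i ∈ s, (P i).degree < N) →
      ∑ i ∈ s, (P i).eval₂ τ x * f i = 0 → ∀ i ∈ s, P i = 0 from
    this (s.sup fun i => (P i).natDegree + 1) P (fun i hi => by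
      refine lt_of_le_of_lt degree_le_natDegree ?_
      have := Finset.le_sup (f := fun i => (P i).natDegree + 1) hi
      exact_mod_cast this) hP
  intro N
  induction N with
  | zero => exact fun P hdeg _ i hi => degree_eq_bot.mp (Nat.WithBot.lt_zero_iff.mp (hdeg i hi))
  | succ N ih =>
    intro P hdeg hsum
    have hsplit : ∑ i ∈ s, (P i).eval₂ τ x * f i =
        x * ∑ i ∈ s, (P i).divX.eval₂ τ x * f i + ∑ i ∈ s, τ ((P i).coeff 0) * f i := by
      rw [Finset.mul_sum, ← Finset.sum_add_distrib]
      refine Finset.sum_congr rfl fun i _ => ?_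
      conv_lhs => rw [← divX_mul_X_add (P i), eval₂_add, eval₂_mul, eval₂_X, eval₂_C]
      ring
    have h0 : ∀ i ∈ s, (P i).coeff 0 = 0 := by
      refine H _ ?_
      rw [hsum] at hsplit
      rw [eq_neg_of_add_eq_zero_right hsplit.symm]
      exact neg_mem (Ideal.mul_mem_right _ _ (Ideal.mem_span_singleton_self x))
    have h1 : ∀ i ∈ s, (P i).divX = 0 := by
      refine ih _ (fun i hi => ?_) (hx ?_)
      · rcases eq_or_ne (P i) 0 with h | h
        · simp [h]
        · have h2 := degree_divX_lt h
          have h3 := hdeg i hi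
          by_contra! hcon
          have h4 := lt_of_le_of_lt hcon h2
          rw [degree_eq_natDegree h] at h3 h4
          norm_cast at h3 h4
          omega
      · have h2 : ∑ i ∈ s, τ ((P i).coeff 0) * f i = 0 :=
          Finset.sum_eq_zero fun i hi => by rw [h0 i hi, map_zero, zero_mul]
        rw [hsum, h2, add_zero] at hsplit
        simpa using hsplit.symm
    intro i hi
    rw [← divX_mul_X_add (P i), h1 i hi, h0 i hi]
    simp

theorem MvPolynomial.eq_zero_of_sum_aeval_mul_eq_zero {k : Type*} [CommRing k] {d : ℕ}
    {A ι : Type*} [CommRing A] [Algebra k A] {a : Fin d → A}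
    (ha : RingTheory.Sequence.IsWeaklyRegular A (List.ofFn a)) (s : Finset ι) (f : ι → A)
    (H : ∀ c : ι → k, ∑ i ∈ s, c i • f i ∈ Ideal.ofList (List.ofFn a) → ∀ i ∈ s, c i = 0)
    (P : ι → MvPolynomial (Fin d) k) (hP : ∑ i ∈ s, aeval a (P i) * f i = 0) :
    ∀ i ∈ s, P i = 0 := by
  induction d generalizing A with
  | zero =>
    intro i hi
    have h0 : ∀ i, P i = C ((P i).coeff 0) := fun i => eq_C_of_isEmpty _
    rw [h0, H (fun i => (P i).coeff 0) ?_ i hi, map_zero]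
    have : ∑ i ∈ s, (P i).coeff 0 • f i = ∑ i ∈ s, aeval a (P i) * f i := by
      refine Finset.sum_congr rfl fun i _ => ?_
      conv_rhs => rw [h0 i, aeval_C, ← Algebra.smul_def]
    rw [this, hP]
    exact zero_mem _
  | succ d ih =>
    rw [List.ofFn_succ, isWeaklyRegular_self_cons_iff, List.map_ofFn] at ha
    let q := Ideal.Quotient.mkₐ k (Ideal.span {a 0})
    have hstep := Polynomial.eq_zero_of_sum_eval₂_mul_eq_zero
      (aeval (R := k) fun i : Fin d => a i.succ).toRingHom ha.1 s f (fun c hc => by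
        refine ih (A := A ⧸ Ideal.span {a 0}) ha.2 (fun i => q (f i)) (fun e he => H e ?_) c ?_
        · have h1 : ∑ i ∈ s, e i • q (f i) = q (∑ i ∈ s, e i • f i) := by
            rw [map_sum]
            exact Finset.sum_congr rfl fun i _ => (map_smul q _ _).symm
          have h2 : Ideal.ofList (List.ofFn (Ideal.Quotient.mk (Ideal.span {a 0}) ∘
              fun i : Fin d => a i.succ)) = (Ideal.ofList (List.ofFn fun i : Fin d => a i.succ)).map
                (Ideal.Quotient.mk (Ideal.span {a 0})) := by
            rw [Ideal.map_ofList, List.map_ofFn]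
          rw [h1, h2] at he
          have := (Ideal.mem_map_iff_of_surjective _ Ideal.Quotient.mk_surjective).mp he
          obtain ⟨y, hy, hyq⟩ := this
          rw [List.ofFn_succ, Ideal.ofList_cons]
          have h3 := Ideal.Quotient.eq.mp hyq.symm
          rw [← sub_add_cancel (∑ i ∈ s, e i • f i) y]
          exact add_mem (Ideal.mem_sup_left h3) (Ideal.mem_sup_right hy)
        · have h1 : ∀ p : MvPolynomial (Fin d) k,
              aeval (Ideal.Quotient.mk (Ideal.span {a 0}) ∘ fun i : Fin d => a i.succ) p =
                q (aeval (fun i : Fin d => a i.succ) p) := fun p => by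
            exact (comp_aeval_apply (fun i : Fin d => a i.succ) q p).symm
          simp_rw [h1, ← map_mul, ← map_sum]
          exact Ideal.Quotient.eq_zero_iff_mem.mpr hc)
      (fun i => finSuccEquiv k d (P i)) (by
        rw [← hP]
        refine Finset.sum_congr rfl fun i _ => ?_
        congr 1
        induction P i using MvPolynomial.induction_on with
        | C c =>
          have : finSuccEquiv k d (C c) = Polynomial.C (C c) := by simp [finSuccEquiv_apply]
          rw [this]
          simp
        | add p q hp hq => rw [map_add, Polynomial.eval₂_add, hp, hq, map_add]
        | mul_X p j hp =>
          rw [map_mul, Polynomial.eval₂_mul, hp, map_mul, aeval_X]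
          congr 1
          refine Fin.cases ?_ (fun j => ?_) j
          · rw [finSuccEquiv_X_zero, Polynomial.eval₂_X]
          · rw [finSuccEquiv_X_succ, Polynomial.eval₂_C]
            simp)
    intro i hi
    simpa using hstep i hi

end LinearIndependence

namespace Blowup

variable {R : Type*} [CommRing R] {𝔞 I : Ideal R} {A : Type*} [CommRing A] [Algebra R A]

section

variable (π : reesAlgebra I →ₐ[R] A)

/-- The class of the degree `n` component of an element of the Rees algebra. -/
noncomputable def component (n : ℕ) : reesAlgebra I →ₗ[R] A :=
  of π n ∘ₗ ((Polynomial.lcoeff R n).restrict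
    (p := Subalgebra.toSubmodule (reesAlgebra I)) fun _ hf => hf n)

theorem component_apply (n : ℕ) (f : reesAlgebra I) :
    component π n f = of π n ⟨(f : Polynomial R).coeff n, f.2 n⟩ := rfl

theorem component_reesMonomial (n m : ℕ) (u : ↥(I ^ m)) :
    component π n (reesMonomial I m u) = if m = n then of π m u else 0 := by
  rw [component_apply]
  split_ifs with h
  · subst h
    congr 1
    exact Subtype.ext (by simp [coe_reesMonomial])
  · rw [← map_zero (of π n)]
    congr 1
    exact Subtype.ext (by simp [coe_reesMonomial, Polynomial.coeff_monomial, h])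

theorem eq_top_of_forall_of_mem (hπ : Function.Surjective π) {B : Type*} [CommRing B] [Algebra B A]
    {K : Submodule B A} (h : ∀ n u, of π n u ∈ K) : K = ⊤ := by
  refine eq_top_iff.mpr fun z _ => ?_
  obtain ⟨f, rfl⟩ := hπ z
  rw [map_eq_sum]
  exact sum_mem fun n _ => h n _

end

theorem IsBlowup.component_mem_ofList {π : reesAlgebra I →ₐ[R] A} (hπ : IsBlowup 𝔞 π)
    {as : List ↥I} {f : reesAlgebra I} (hf : π f ∈ Ideal.ofList (as.map (degOne π))) (n : ℕ) :
    component π n f ∈ Ideal.ofList (as.map (degOne π)) :=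
  hπ.of_mem_ofList ((hπ.map_mem_ofList_iff as f).mp hf n)

section Polynomial

variable {k : Type*} {as : List ↥I} {π : reesAlgebra I →ₐ[R] A}

/-- The pieces of degree at most `n₀` generate, since beyond `n₀` each degree is obtained from the
previous one by multiplying with the forms of `as`. -/
theorem finite_mvPolynomial [CommRing k] [Algebra R k] [IsNoetherianRing R]
    [Algebra (MvPolynomial (Fin as.length) k) A]
    [IsScalarTower R (MvPolynomial (Fin as.length) k) A]
    (hX : ∀ i, algebraMap (MvPolynomial (Fin as.length) k) A (MvPolynomial.X i) =
      degOne π (as.get i)) (hπ : Function.Surjective π) {n₀ : ℕ}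
    (hred : I ^ (n₀ + 1) ≤ Ideal.ofList (as.map Subtype.val) * I ^ n₀) :
    Module.Finite (MvPolynomial (Fin as.length) k) A := by
  let B := MvPolynomial (Fin as.length) k
  let N : ℕ → Submodule B A := fun n => Submodule.span B (LinearMap.range (of π n))
  have hN : ∀ n, (N n).FG := by
    intro n
    obtain ⟨t, ht⟩ : (LinearMap.range (of π n)).FG := by
      rw [LinearMap.range_eq_map]
      exact (IsNoetherian.noetherian (⊤ : Submodule R ↥(I ^ n))).map _
    refine ⟨t, ?_⟩
    simp only [N]
    rw [← ht, Submodule.span_span_of_tower]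
  let K : Submodule B A := ⨆ n ∈ Finset.range (n₀ + 1), N n
  have hK : K = ⊤ := by
    refine eq_top_of_forall_of_mem π hπ fun n => ?_
    induction n with
    | zero =>
      exact fun u => le_biSup N (Finset.mem_range.mpr n₀.succ_pos)
        (Submodule.subset_span ⟨u, rfl⟩)
    | succ n ih =>
      intro u
      rcases lt_or_ge n n₀ with h | h
      · exact le_biSup N (Finset.mem_range.mpr (Nat.succ_lt_succ h))
          (Submodule.subset_span ⟨u, rfl⟩)
      · refine of_succ_mem_of_mem_ofList_mul π (as := as) (fun a ha v => ?_) ?_ _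
        · obtain ⟨i, rfl⟩ := List.mem_iff_get.mp ha
          rw [← hX i, ← Algebra.smul_def]
          exact K.smul_mem _ (ih v)
        · obtain ⟨m, rfl⟩ := Nat.exists_eq_add_of_le h
          have h1 : I ^ (n₀ + m + 1) ≤ Ideal.ofList (as.map Subtype.val) * I ^ (n₀ + m) := by
            rw [add_right_comm, pow_add, pow_add I n₀ m, ← mul_assoc]
            exact Ideal.mul_mono_left hred
          exact h1 u.2
  refine ⟨hK ▸ ?_⟩
  exact Submodule.fg_biSup _ _ fun n _ => hN n

theorem algebraMap_eq_aeval [CommRing k] [Algebra k A]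
    [Algebra (MvPolynomial (Fin as.length) k) A]
    [IsScalarTower k (MvPolynomial (Fin as.length) k) A]
    (hX : ∀ i, algebraMap (MvPolynomial (Fin as.length) k) A (MvPolynomial.X i) =
      degOne π (as.get i)) (p : MvPolynomial (Fin as.length) k) :
    algebraMap (MvPolynomial (Fin as.length) k) A p =
      MvPolynomial.aeval (fun i => degOne π (as.get i)) p := by
  have : IsScalarTower.toAlgHom k (MvPolynomial (Fin as.length) k) A =
      MvPolynomial.aeval (fun i => degOne π (as.get i)) := by
    refine MvPolynomial.algHom_ext fun i => ?_
    rw [IsScalarTower.toAlgHom_apply, hX, MvPolynomial.aeval_X]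
  exact DFunLike.congr_fun this p

theorem IsBlowup.linearIndependent_mvPolynomial (hπ : IsBlowup 𝔞 π) [CommRing k] [Algebra k A]
    [Algebra (MvPolynomial (Fin as.length) k) A]
    [IsScalarTower k (MvPolynomial (Fin as.length) k) A]
    (hX : ∀ i, algebraMap (MvPolynomial (Fin as.length) k) A (MvPolynomial.X i) =
      degOne π (as.get i)) (has : FormRegular 𝔞 as) {κ : Type*} {f : κ → A}
    (hf : LinearIndependent k
      (Ideal.Quotient.mkₐ k (Ideal.ofList (as.map (degOne π))) ∘ f)) :
    LinearIndependent (MvPolynomial (Fin as.length) k) f := by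
  have hlist : as.map (degOne π) = List.ofFn fun i => degOne π (as.get i) := by
    conv_lhs => rw [← List.ofFn_get as, List.map_ofFn]
    rfl
  rw [linearIndependent_iff']
  intro s g hg
  refine MvPolynomial.eq_zero_of_sum_aeval_mul_eq_zero
    (hlist ▸ (hπ.isWeaklyRegular_iff as).mpr has) s f (fun c hc => ?_) g ?_
  · refine linearIndependent_iff'.mp hf s c ?_
    rw [← hlist, ← Ideal.Quotient.eq_zero_iff_mem] at hc
    refine Eq.trans ?_ hc
    rw [map_sum]
    exact Finset.sum_congr rfl fun i _ => rfl
  · rw [← hg]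
    exact Finset.sum_congr rfl fun i _ => by rw [← algebraMap_eq_aeval hX, Algebra.smul_def]

/-- Modulo the forms of `as`, the homogeneous elements of the span of a family of homogeneous
elements are spanned by the members of the family of the same degree. -/
theorem IsBlowup.exists_sub_mem_ofList (hπ : IsBlowup 𝔞 π) [CommRing k] [Algebra R k] [Algebra k A]
    [IsScalarTower R k A] (hk : Function.Surjective (algebraMap R k)) {κ : Type*}
    {b : κ → Σ n, ↥(I ^ n)} {n : ℕ} {u : ↥(I ^ n)}
    (hu : Ideal.Quotient.mkₐ k (Ideal.ofList (as.map (degOne π))) (of π n u) ∈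
      Submodule.span k (Set.range fun i =>
        Ideal.Quotient.mkₐ k (Ideal.ofList (as.map (degOne π))) (of π (b i).1 (b i).2))) :
    ∃ w : ↥(I ^ n), of π n w ∈ Submodule.span R (Set.range fun i => of π (b i).1 (b i).2) ∧
      of π n (u - w) ∈ Ideal.ofList (as.map (degOne π)) := by
  obtain ⟨c, hc⟩ := (Finsupp.mem_span_range_iff_exists_finsupp).mp hu
  choose lift hlift using hk
  -- The linear combination is lifted to the Rees algebra, where its degree `n` coefficient can be
  -- extracted.
  obtain ⟨g, hgdef⟩ : ∃ g : reesAlgebra I,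
      g = ∑ i ∈ c.support, lift (c i) • reesMonomial I (b i).1 (b i).2 := ⟨_, rfl⟩
  refine ⟨⟨(g : Polynomial R).coeff n, g.2 n⟩, ?_, ?_⟩
  · rw [← component_apply, hgdef, map_sum]
    refine sum_mem fun i _ => ?_
    rw [map_smul, component_reesMonomial]
    refine Submodule.smul_mem _ _ ?_
    split_ifs
    · exact Submodule.subset_span ⟨i, rfl⟩
    · exact zero_mem _
  · have hg : Ideal.Quotient.mkₐ k (Ideal.ofList (as.map (degOne π))) (π g) =
        Ideal.Quotient.mkₐ k (Ideal.ofList (as.map (degOne π))) (of π n u) := by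
      rw [← hc, hgdef, Finsupp.sum, map_sum, map_sum]
      refine Finset.sum_congr rfl fun i _ => ?_
      rw [map_smul, ← of_apply, ← map_smul (Ideal.Quotient.mkₐ k _)]
      congr 1
      conv_rhs => rw [← hlift (c i), algebraMap_smul]
    have hg' : π (reesMonomial I n u - g) ∈ Ideal.ofList (as.map (degOne π)) := by
      rw [map_sub]
      exact Ideal.Quotient.eq.mp hg.symm
    have := hπ.component_mem_ofList hg' n
    rw [map_sub, component_reesMonomial, if_pos rfl, component_apply] at this
    rwa [map_sub]

/-- Graded Nakayama by induction on the degree; no finiteness is needed. -/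
theorem IsBlowup.eq_top_of_span_quotient_eq (hπ : IsBlowup 𝔞 π) [CommRing k]
    [Algebra R k] [Algebra k A] [IsScalarTower R k A] (hk : Function.Surjective (algebraMap R k))
    [Algebra (MvPolynomial (Fin as.length) k) A]
    [IsScalarTower k (MvPolynomial (Fin as.length) k) A]
    (hX : ∀ i, algebraMap (MvPolynomial (Fin as.length) k) A (MvPolynomial.X i) =
      degOne π (as.get i)) {κ : Type*} {b : κ → Σ n, ↥(I ^ n)}
    (hspan : ∀ n u, Ideal.Quotient.mkₐ k (Ideal.ofList (as.map (degOne π))) (of π n u) ∈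
      Submodule.span k (Set.range fun i =>
        Ideal.Quotient.mkₐ k (Ideal.ofList (as.map (degOne π))) (of π (b i).1 (b i).2)))
    {K : Submodule (MvPolynomial (Fin as.length) k) A} (hbK : ∀ i, of π (b i).1 (b i).2 ∈ K) :
    K = ⊤ := by
  have hKR : ∀ z ∈ Submodule.span R (Set.range fun i => of π (b i).1 (b i).2), z ∈ K := by
    intro z hz
    induction hz using Submodule.span_induction with
    | mem z hz =>
      obtain ⟨i, rfl⟩ := hz
      exact hbK i
    | zero => exact zero_mem K
    | add x y _ _ hx hy => exact add_mem hx hy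
    | smul r z _ hz =>
      have : r • z = algebraMap k (MvPolynomial (Fin as.length) k) (algebraMap R k r) • z := by
        rw [algebraMap_smul, algebraMap_smul]
      rw [this]
      exact K.smul_mem _ hz
  refine eq_top_of_forall_of_mem π hπ.surjective fun n => ?_
  induction n with
  | zero =>
    intro u
    obtain ⟨w, hw, huw⟩ := hπ.exists_sub_mem_ofList hk (hspan 0 u)
    have h0 : of π 0 (u - w) = 0 := by
      rw [hπ.of_mem_ofList_iff] at huw
      exact (hπ.of_eq_zero_iff _).mpr (by simpa [slice] using huw)
    rw [map_sub, sub_eq_zero] at h0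
    exact h0 ▸ hKR _ hw
  | succ n ih =>
    intro u
    obtain ⟨w, hw, huw⟩ := hπ.exists_sub_mem_ofList hk (hspan (n + 1) u)
    rw [hπ.of_mem_ofList_iff, slice] at huw
    obtain ⟨x, hx, y, hy, hxy⟩ := Submodule.mem_sup.mp huw
    have hle : Ideal.ofList (as.map Subtype.val) * I ^ n ≤ I ^ (n + 1) := by
      rw [pow_succ']
      exact Ideal.mul_mono_left (ofList_map_val_le as)
    have hx0 : of π (n + 1) ⟨x, Ideal.mul_le_right hx⟩ = 0 := (hπ.of_eq_zero_iff _).mpr hx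
    have hyK : of π (n + 1) ⟨y, hle hy⟩ ∈ K := by
      refine of_succ_mem_of_mem_ofList_mul π (fun a ha v => ?_) hy _
      obtain ⟨i, rfl⟩ := List.mem_iff_get.mp ha
      rw [← hX i, ← Algebra.smul_def]
      exact K.smul_mem _ (ih v)
    have hu : u = w + (⟨x, Ideal.mul_le_right hx⟩ + ⟨y, hle hy⟩) := by
      refine Subtype.ext ?_
      have : x + y = (u : R) - w := hxy
      change (u : R) = w + (x + y)
      rw [this, add_sub_cancel]
    rw [hu, map_add, map_add, hx0, zero_add]
    exact add_mem (hKR _ hw) hyK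

theorem IsBlowup.free_mvPolynomial (hπ : IsBlowup 𝔞 π) [Field k] [Algebra R k] [Algebra k A]
    [IsScalarTower R k A] (hk : Function.Surjective (algebraMap R k))
    [Algebra (MvPolynomial (Fin as.length) k) A]
    [IsScalarTower k (MvPolynomial (Fin as.length) k) A]
    (hX : ∀ i, algebraMap (MvPolynomial (Fin as.length) k) A (MvPolynomial.X i) =
      degOne π (as.get i)) (has : FormRegular 𝔞 as) :
    Module.Free (MvPolynomial (Fin as.length) k) A := by
  -- Homogeneous classes span the quotient by the forms, so a `k`-basis can be chosen among them.
  -- Their representatives in `A` form a basis over the polynomial ring.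
  obtain ⟨κ, b, -, hspan, hli⟩ := exists_linearIndependent' k fun j : Σ n, ↥(I ^ n) =>
    Ideal.Quotient.mkₐ k (Ideal.ofList (as.map (degOne π))) (of π j.1 j.2)
  have hindep := hπ.linearIndependent_mvPolynomial hX has
    (f := fun i => of π (b i).1 (b i).2) hli
  refine Module.Free.of_basis (Module.Basis.mk hindep (ge_of_eq ?_))
  refine hπ.eq_top_of_span_quotient_eq hk hX (b := b) (fun n u => ?_)
    fun i => Submodule.subset_span ⟨i, rfl⟩
  exact hspan.ge (Submodule.subset_span ⟨⟨n, u⟩, rfl⟩)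

end Polynomial

theorem IsBlowup.isCohenMacaulayRing_of_formRegular [IsLocalRing R] [IsNoetherianRing R]
    {π : reesAlgebra I →ₐ[R] A} (hπ : IsBlowup (maximalIdeal R) π) {as : List ↥I} {n₀ : ℕ}
    (hred : I ^ (n₀ + 1) ≤ Ideal.ofList (as.map Subtype.val) * I ^ n₀)
    (has : FormRegular (maximalIdeal R) as) : IsCohenMacaulayRing A := by
  let ψ : ResidueField R →+* A := Ideal.Quotient.lift (maximalIdeal R) (algebraMap R A) fun r hr => by
    rw [← (of_zero_apply π ⟨r, by simp⟩), hπ.of_eq_zero_iff]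
    simpa using hr
  let _ : Algebra (ResidueField R) A := ψ.toAlgebra
  have _ : IsScalarTower R (ResidueField R) A := .of_algebraMap_eq fun r => rfl
  let B := MvPolynomial (Fin as.length) (ResidueField R)
  let φ : B →ₐ[ResidueField R] A := MvPolynomial.aeval fun i => degOne π (as.get i)
  let _ : Algebra B A := φ.toRingHom.toAlgebra
  have _ : IsScalarTower (ResidueField R) B A :=
    .of_algebraMap_eq fun r => (φ.commutes r).symm
  have _ : IsScalarTower R B A := .of_algebraMap_eq fun r => (φ.commutes (algebraMap R _ r)).symm
  have hX : ∀ i, algebraMap B A (MvPolynomial.X i) = degOne π (as.get i) := fun i =>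
    MvPolynomial.aeval_X _ _
  have : Module.Finite B A := finite_mvPolynomial hX hπ.surjective hred
  have : Module.Free B A := hπ.free_mvPolynomial Ideal.Quotient.mk_surjective hX has
  have : IsNoetherianRing A :=
    isNoetherianRing_of_surjective (reesAlgebra I) A π.toRingHom hπ.surjective
  exact isCohenMacaulayRing_of_flat_mvPolynomial (ResidueField R) (d := as.length)

end Blowup

/-! ### The criterion for the fiber cone and the two cases. -/

theorem isCohenMacaulayRing_fiberCone {R : Type*} [CommRing R] [IsLocalRing R]
    (hR : IsCohenMacaulayLocalRing R) [Infinite (ResidueField R)] {d : ℕ}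
    (hdim : ringKrullDim R = (d + 1 : ℕ)) {I J : Ideal R} (hI : I.radical = maximalIdeal R)
    (hG : (d : ℕ∞) ≤ depthAssociatedGradedRing I) (hJ : IsMinimalReduction J I)
    (hstar : ∀ n, J * I ^ n ⊓ maximalIdeal R * I ^ (n + 1) ≤ maximalIdeal R * (J * I ^ n)) :
    IsCohenMacaulayRing (FiberCone I) := by
  have hIm : I ≤ maximalIdeal R := hI ▸ Ideal.le_radical
  have := hR.1
  have hgrade : ((d + 1 : ℕ) : ℕ∞) ≤ (maximalIdeal R).regularGrade := by
    have h := hR.2.trans hdim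
    have h' : (maximalIdeal R).regularGrade = (d + 1 : ℕ) := by exact_mod_cast h
    exact h'.ge
  obtain ⟨rs, hrsl, hrs, hrsreg⟩ := Ideal.exists_isWeaklyRegular_of_le_regularGrade hgrade
  obtain ⟨ts, htsl, hts, htsreg⟩ := Ideal.exists_isWeaklyRegular_of_le_regularGrade hG
  have hnoeth : @IsNoetherianRing (AssociatedGradedRing I)
      (CommRing.toCommSemiring (α := AssociatedGradedRing I)).toSemiring :=
    isNoetherianRing_of_surjective (reesAlgebra I) (AssociatedGradedRing I)
      (Ideal.Quotient.mk _) Ideal.Quotient.mk_surjective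
  obtain ⟨as, rfl, hreg, hVV⟩ := Blowup.exists_generators_of_isBlowup
    (Blowup.isBlowup_blowupMk I I) hIm hI.ge hJ hdim hrsl hrs hrsreg htsl hts htsreg
  obtain ⟨n₀, hred⟩ := hJ.1.2
  exact (Blowup.isBlowup_blowupMk (maximalIdeal R) I).isCohenMacaulayRing_of_formRegular hred.le
    (Blowup.formRegular_of_inf_le hreg hVV hIm hstar)

theorem IsMinimalReduction.mul_pow_inf_le {R : Type*} [CommRing R] [IsLocalRing R]
    [IsNoetherianRing R] {I J : Ideal R} (hJ : IsMinimalReduction J I)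
    (h1 : J * I ⊓ maximalIdeal R * I ^ 2 ≤ maximalIdeal R * (J * I))
    (h2 : ∀ n, 2 ≤ n → maximalIdeal R * I ^ (n + 1) ≤ maximalIdeal R * (J * I ^ n)) (n : ℕ) :
    J * I ^ n ⊓ maximalIdeal R * I ^ (n + 1) ≤ maximalIdeal R * (J * I ^ n) := by
  rcases n with _ | _ | n
  · simpa using hJ.inf_maximalIdeal_mul_le
  · simpa using h1
  · exact inf_le_right.trans (h2 (n + 2) (by omega))

theorem proposition4p6 {R : Type*} [CommRing R] [IsLocalRing R]
    (hR : IsCohenMacaulayLocalRing R) (hk : Infinite (ResidueField R))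
    (d : ℕ) (hd : 2 ≤ d) (hdim : ringKrullDim R = d)
    (I J : Ideal R) (hI : I.radical = maximalIdeal R)
    (hG : ((d - 1 : ℕ) : ℕ∞) ≤ depthAssociatedGradedRing I)
    (hJ : IsMinimalReduction J I) :
    ((lengthQuotient (maximalIdeal R * I) (maximalIdeal R * J) = 1 ∧
        lengthQuotient (maximalIdeal R * I ^ 2) (maximalIdeal R * (I * J)) = 1 ∧
        (∀ n : ℕ, 2 ≤ n → maximalIdeal R * I ^ (n + 1) = maximalIdeal R * I ^ n * J)) →
      (IsCohenMacaulayRing (FiberCone I) ↔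
        maximalIdeal R * I ^ 2 ⊓ J * I = maximalIdeal R * (I * J))) ∧
    ((lengthQuotient (maximalIdeal R * I) (maximalIdeal R * J) = 2 ∧
        maximalIdeal R * I ^ 2 = maximalIdeal R * (J * I)) →
      IsCohenMacaulayRing (FiberCone I)) := by
  have := hR.1
  obtain ⟨d, rfl⟩ : ∃ e, d = e + 1 := ⟨d - 1, by omega⟩
  rw [Nat.add_sub_cancel] at hG
  have hIm : I ≤ maximalIdeal R := hI ▸ Ideal.le_radical
  refine ⟨fun ⟨_, _, hn⟩ => ⟨fun hF => ?_, fun h => ?_⟩, fun ⟨_, h⟩ => ?_⟩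
  · have hnoeth : @IsNoetherianRing (FiberCone I)
        (CommRing.toCommSemiring (α := FiberCone I)).toSemiring := hF.1
    obtain ⟨as, rfl, has⟩ := Blowup.exists_formRegular_of_isCohenMacaulay
      (Blowup.isBlowup_blowupMk (maximalIdeal R) I) hIm hI.ge hJ hF
    refine le_antisymm has.inf_le (le_inf ?_ ?_)
    · rw [pow_two]
      exact Ideal.mul_mono_right (Ideal.mul_mono_right hJ.1.1)
    · rw [mul_comm I]
      exact Ideal.mul_le_right
  · refine isCohenMacaulayRing_fiberCone hR hdim hI hG hJ (hJ.mul_pow_inf_le ?_ fun n h2 => ?_)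
    · rw [inf_comm, h, mul_comm I]
    · rw [hn n h2, mul_assoc, mul_comm J]
  · refine isCohenMacaulayRing_fiberCone hR hdim hI hG hJ
      (hJ.mul_pow_inf_le (inf_le_right.trans h.le) fun n h2 => ?_)
    obtain ⟨n, rfl⟩ := Nat.exists_eq_add_of_le h2
    refine le_of_eq ?_
    -- Multiplying `𝔪 I² = 𝔪 J I` by powers of `I` gives the condition in all higher degrees.
    calc maximalIdeal R * I ^ (2 + n + 1) = maximalIdeal R * I ^ 2 * I ^ (n + 1) := by ring
      _ = maximalIdeal R * (J * I ^ (2 + n)) := by rw [h]; ring
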